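/- Let $n\ge 1$, $N=2^n$, and let $R_n=\mathbb{Z}[x]/(x^{N}+1)$. The coefficient embedding sends $a_0+a_1x+\dots+a_{N-1}x^{N-1}\in R_n$ to $(a_0,\dots,a_{N-1})\in\mathbb{R}^N$; for an ideal $\mathcal I$ of $R_n$, a \emph{shortest vector} of $\mathcal I$ is a nonzero element of $\mathcal I$ whose image has the smallest Euclidean norm among all nonzero elements of $\mathcal I$, and $\mathcal N(\mathcal I)=|R_n/\mathcal I|$. There is a single algorithm with the following property. Let $\mathcal I=\mathfrak p_1\mathfrak p_2\cdots\mathfrak p_k$ be an ideal of $R_n$, where each $\mathfrak p_i$ is a prime ideal containing a prime number $\equiv\pm 3\pmod 8$ (which may depend on $i$). Given $n$ and the coefficient vectors of a finite generating set of $\mathcal I$ (but not the factorization of $\mathcal I$), the algorithm outputs the coefficient vector of a shortest vector of $\mathcal I$ in time polynomial in $N$ and $\log\mathcal N(\mathcal I)$. Here the input may be any generating set whose total bit length is polynomial in $N$ and $\log\mathcal N(\mathcal I)$, such as the Hermite normal form $\mathbb Z$-basis: for every $d$ there are constants $C,e$, not depending on $n$, $\mathcal I$ or the generators, such that on inputs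 of bit length at most $(N+\lfloor\log_2\mathcal N(\mathcal I)\rfloor)^d$ the running time is at most $C\,(N+\lfloor\log_2\mathcal N(\mathcal I)\rfloor)^{e}$. Running time means the bit cost of a program over integer memory cells (with assignment, indirect addressing, sequencing, branching and loops): each memory access, addition or subtraction is charged linearly, and each multiplication or integer division quadratically, in the bit lengths of the integers involved. -/

import Mathlib

/-! ### The machine model: programs over integer memory cells with logarithmic (bit) cost -/

/-- The memory: every cell, addressed by an integer, holds an integer of arbitrary size. -/
abbrev Mem : Type := ℤ → ℤ

/-- The number of bits needed to write down an integer, including its sign. -/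
def bitLen (z : ℤ) : ℕ := Nat.size z.natAbs + 1

/-- Arithmetic expressions. `mem e` reads the cell whose address is the value of `e`
(indirect addressing), and `div` is integer division `⌊a / b⌋` (for positive `b`). -/
inductive Expr : Type
  | const (c : ℤ) : Expr
  | mem (a : Expr) : Expr
  | add (a b : Expr) : Expr
  | sub (a b : Expr) : Expr
  | mul (a b : Expr) : Expr
  | div (a b : Expr) : Expr

/-- The value of an expression. -/
def Expr.eval (μ : Mem) : Expr → ℤ
  | .const c => c
  | .mem a => μ (a.eval μ)
  | .add a b => a.eval μ + b.eval μ
  | .sub a b => a.eval μ - b.eval μ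
  | .mul a b => a.eval μ * b.eval μ
  | .div a b => a.eval μ / b.eval μ

/-- The cost of evaluating an expression. Each operation is charged by the bit lengths of the
integers (and addresses) that it handles: linearly for memory access, addition and subtraction,
and by the schoolbook bound for multiplication and division. -/
def Expr.cost (μ : Mem) : Expr → ℕ
  | .const c => bitLen c
  | .mem a => a.cost μ + bitLen (a.eval μ) + bitLen (μ (a.eval μ))
  | .add a b => a.cost μ + b.cost μ + bitLen (a.eval μ) + bitLen (b.eval μ)
  | .sub a b => a.cost μ + b.cost μ + bitLen (a.eval μ) + bitLen (b.eval μ)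
  | .mul a b => a.cost μ + b.cost μ + bitLen (a.eval μ) * bitLen (b.eval μ)
  | .div a b => a.cost μ + b.cost μ + bitLen (a.eval μ) * bitLen (b.eval μ)

/-- Programs. `assign a e` stores the value of `e` in the cell whose address is the value of `a`;
`branch c P Q` runs `P` if `c` is positive and `Q` otherwise; `loop c P` repeats `P` as long as `c`
is positive. -/
inductive Prog : Type
  | skip : Prog
  | assign (a e : Expr) : Prog
  | seq (P Q : Prog) : Prog
  | branch (c : Expr) (P Q : Prog) : Prog
  | loop (c : Expr) (P : Prog) : Prog

/-- `Exec P μ ν t`: started on the memory `μ`, the program `P` halts with the memory `ν`, and the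
total cost of the run is `t`. -/
inductive Exec : Prog → Mem → Mem → ℕ → Prop
  | skip (μ : Mem) : Exec .skip μ μ 1
  | assign (a e : Expr) (μ : Mem) :
      Exec (.assign a e) μ (Function.update μ (a.eval μ) (e.eval μ))
        (a.cost μ + e.cost μ + bitLen (a.eval μ) + bitLen (e.eval μ))
  | seq {P Q : Prog} {μ ν ρ : Mem} {s t : ℕ} :
      Exec P μ ν s → Exec Q ν ρ t → Exec (.seq P Q) μ ρ (s + t)
  | branch_pos {c : Expr} {P Q : Prog} {μ ν : Mem} {t : ℕ} :
      0 < c.eval μ → Exec P μ ν t → Exec (.branch c P Q) μ ν (c.cost μ + bitLen (c.eval μ) + t)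
  | branch_neg {c : Expr} {P Q : Prog} {μ ν : Mem} {t : ℕ} :
      ¬ 0 < c.eval μ → Exec Q μ ν t → Exec (.branch c P Q) μ ν (c.cost μ + bitLen (c.eval μ) + t)
  | loop_done {c : Expr} {P : Prog} {μ : Mem} :
      ¬ 0 < c.eval μ → Exec (.loop c P) μ μ (c.cost μ + bitLen (c.eval μ))
  | loop_step {c : Expr} {P : Prog} {μ ν ρ : Mem} {s t : ℕ} :
      0 < c.eval μ → Exec P μ ν s → Exec (.loop c P) ν ρ t →
        Exec (.loop c P) μ ρ (c.cost μ + bitLen (c.eval μ) + s + t)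

/-- Runs are deterministic: result and cost are determined by the program and the input. -/
theorem Exec.deterministic {P : Prog} {μ ν ν' : Mem} {t t' : ℕ}
    (h : Exec P μ ν t) (h' : Exec P μ ν' t') : ν = ν' ∧ t = t' := by
  induction h generalizing ν' t' with
  | skip => cases h'; exact ⟨rfl, rfl⟩
  | assign => cases h'; exact ⟨rfl, rfl⟩
  | seq _ _ ih₁ ih₂ =>
    cases h' with
    | seq a b =>
      obtain ⟨rfl, rfl⟩ := ih₁ a
      obtain ⟨rfl, rfl⟩ := ih₂ b
      exact ⟨rfl, rfl⟩
  | branch_pos hc _ ih =>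
    cases h' with
    | branch_pos _ a => obtain ⟨rfl, rfl⟩ := ih a; exact ⟨rfl, rfl⟩
    | branch_neg hn _ => exact absurd hc hn
  | branch_neg hc _ ih =>
    cases h' with
    | branch_pos hn _ => exact absurd hn hc
    | branch_neg _ a => obtain ⟨rfl, rfl⟩ := ih a; exact ⟨rfl, rfl⟩
  | loop_done hc =>
    cases h' with
    | loop_done _ => exact ⟨rfl, rfl⟩
    | loop_step hn _ _ => exact absurd hn hc
  | loop_step hc _ _ ih₁ ih₂ =>
    cases h' with
    | loop_done hn => exact absurd hc hn
    | loop_step _ a b =>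
      obtain ⟨rfl, rfl⟩ := ih₁ a
      obtain ⟨rfl, rfl⟩ := ih₂ b
      exact ⟨rfl, rfl⟩

/-- The initial memory for an input list: its entries occupy the cells `0, 1, 2, …`, and all other
cells hold `0`. -/
def initMem (l : List ℤ) : Mem := fun a => if 0 ≤ a then l.getD a.toNat 0 else 0

/-- The total bit length of an input. -/
def inputSize (l : List ℤ) : ℕ := (l.map bitLen).sum

/-! ### The ring `ℤ[x] / (x ^ (2 ^ n) + 1)` and its coefficient embedding -/

/-- The ring `ℤ[x] / (x ^ (2 ^ n) + 1)`. -/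
abbrev NegacyclicRing (n : ℕ) : Type :=
  AdjoinRoot (Polynomial.X ^ 2 ^ n + 1 : Polynomial ℤ)

theorem negacyclic_monic (n : ℕ) : (Polynomial.X ^ 2 ^ n + 1 : Polynomial ℤ).Monic := by
  simpa using Polynomial.monic_X_pow_add_C (1 : ℤ) (pow_ne_zero n two_ne_zero)

/-- The `i`-th coefficient of the representative of degree less than `2 ^ n` of `z`. -/
noncomputable def ringCoeff (n : ℕ) (z : NegacyclicRing n) (i : ℕ) : ℤ :=
  (AdjoinRoot.modByMonicHom (negacyclic_monic n) z).coeff i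

/-- The coefficient embedding
`a₀ + a₁ x + ⋯ + a_{N-1} x ^ (N-1) ↦ (a₀, a₁, …, a_{N-1})` into Euclidean space, `N = 2 ^ n`. -/
noncomputable def coeffEmbedding (n : ℕ) (z : NegacyclicRing n) :
    EuclideanSpace ℝ (Fin (2 ^ n)) :=
  WithLp.toLp 2 fun i => (ringCoeff n z i : ℝ)

/-- `v` is a shortest nonzero vector of the ideal lattice of `I` under the coefficient embedding. -/
def IsShortestVector (n : ℕ) (I : Ideal (NegacyclicRing n)) (v : NegacyclicRing n) : Prop :=
  v ∈ I ∧ v ≠ 0 ∧ ∀ w ∈ I, w ≠ 0 → ‖coeffEmbedding n v‖ ≤ ‖coeffEmbedding n w‖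

/-- The norm of an ideal: the cardinality of the quotient ring. -/
noncomputable def idealNorm (n : ℕ) (I : Ideal (NegacyclicRing n)) : ℕ :=
  Nat.card (NegacyclicRing n ⧸ I)

/-- The input that presents the ideal generated by `g₁, …, g_m` to a machine: the integers `n` and
`m`, followed by the coefficient vectors of `g₁, …, g_m`. -/
noncomputable def encodeIdeal (n : ℕ) (gens : List (NegacyclicRing n)) : List ℤ :=
  (n : ℤ) :: (gens.length : ℤ) ::
    gens.flatMap fun g => (List.range (2 ^ n)).map fun i => ringCoeff n g i

/-! ### Cost of loop-free programs -/

/-! Write `q = 2 ^ n / 4` and let `n ≥ 2`. Then `y = x ^ q` satisfies `y ^ 4 = -1`, so the ring is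
free over `Z8 = ℤ[ζ]` with basis `1, x, …, x ^ (q - 1)`, and the squared coefficient length is the
sum of the squared lengths of the `Z8`-components (`coeffSq_eq_sum`).

Primes over `p ≡ ±3 (mod 8)` are extended from `Z8` (`exists_eq_map_fromZ8_of_isPrime`). Modulo `p`,
either `-2` or `-1` is a square, so `y ^ 4 + 1` splits into two quadratics and the prime contains
one of them, a polynomial of degree `2 q` in `x`. On the other hand `p` has order `2 ^ (n - 1) = 2
q` modulo `2 ^ (n + 1)`, and this is the degree of every irreducible factor of `X ^ 2 ^ n + 1` over
`ZMod p`. So the quadratic is the minimal polynomial of `x` modulo the prime, which is therefore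
generated by it and `p`. Products of extended ideals are extended, so `I` is the extension of some
`J`, and the components of any generators of `I` generate `J` (`span_component`). No factorization
is needed.

`Z8` is norm-Euclidean (`Z8.nm_rem_le`), so the Euclidean algorithm finds `z` with `J = (z)`. Put `s
= sqLen` and `c = cross`; then `z` times its complex conjugate is `s + c √2`, and the squared length
of `z w` is `s_z s_w + 2 c_z c_w`. If `2 |c_z| ≤ s_z`, this is at least `s_z (s_w - |c_w|) ≥ s_z`
for `w ≠ 0`, so `z` is shortest in `J`. Multiplication by the units `√2 ± 1` reaches this situation.
A nonzero element of `I` has a nonzero component, which is a multiple of `z`, so `z` is shortest in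
`I` too.

For the cost, a division with rounding shrinks the norm by the factor `11/16`, while the remainder
has coefficients at most twice as large as those of the divisor. With input length `L`, both the
number of steps and the bit lengths are `O(L ^ 2)`, and the cost is `O(L ^ 6)`.

For `n = 1` the ring is `ℤ[i]`, embedded in `Z8` by `x ↦ ζ ^ 2`. The same program then never leaves
the elements with vanishing odd coefficients. -/

theorem bitLen_le_iff {z : ℤ} {k : ℕ} : bitLen z ≤ k + 1 ↔ z.natAbs < 2 ^ k := by
  simp [bitLen, Nat.size_le]

theorem one_le_bitLen (z : ℤ) : 1 ≤ bitLen z := by simp [bitLen]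

theorem bitLen_mono {x y : ℤ} (h : x.natAbs ≤ y.natAbs) : bitLen x ≤ bitLen y := by
  simpa [bitLen] using Nat.size_le_size h

theorem natAbs_lt_two_pow_bitLen (z : ℤ) : z.natAbs < 2 ^ (bitLen z - 1) := by
  simpa [bitLen] using Nat.lt_size_self z.natAbs

theorem bitLen_le_of_natAbs_le_add {x y z : ℤ} (h : z.natAbs ≤ x.natAbs + y.natAbs) :
    bitLen z ≤ bitLen x + bitLen y := by
  have hx := natAbs_lt_two_pow_bitLen x
  have hy := natAbs_lt_two_pow_bitLen y
  have h1 := one_le_bitLen x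
  have h2 := one_le_bitLen y
  obtain ⟨i, hi⟩ := Nat.exists_eq_add_of_le h1
  obtain ⟨j, hj⟩ := Nat.exists_eq_add_of_le h2
  rw [hi] at hx ⊢
  rw [hj] at hy ⊢
  have : 1 + i + (1 + j) = (i + j + 1) + 1 := by ring
  rw [this, bitLen_le_iff]
  simp only [Nat.add_sub_cancel_left] at hx hy
  have h3 : 2 ^ i ≤ 2 ^ (i + j) := Nat.pow_le_pow_right (by norm_num) (by omega)
  have h4 : 2 ^ j ≤ 2 ^ (i + j) := Nat.pow_le_pow_right (by norm_num) (by omega)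
  rw [pow_succ]
  omega

theorem bitLen_add (x y : ℤ) : bitLen (x + y) ≤ bitLen x + bitLen y :=
  bitLen_le_of_natAbs_le_add (Int.natAbs_add_le x y)

theorem bitLen_sub (x y : ℤ) : bitLen (x - y) ≤ bitLen x + bitLen y :=
  bitLen_le_of_natAbs_le_add (Int.natAbs_sub_le x y)

theorem bitLen_mul (x y : ℤ) : bitLen (x * y) ≤ bitLen x + bitLen y := by
  have hx := natAbs_lt_two_pow_bitLen x
  have hy := natAbs_lt_two_pow_bitLen y
  have h1 := one_le_bitLen x
  have h2 := one_le_bitLen y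
  obtain ⟨i, hi⟩ := Nat.exists_eq_add_of_le h1
  obtain ⟨j, hj⟩ := Nat.exists_eq_add_of_le h2
  rw [hi] at hx ⊢
  rw [hj] at hy ⊢
  have : 1 + i + (1 + j) = (i + j + 1) + 1 := by ring
  rw [this, bitLen_le_iff, Int.natAbs_mul]
  simp only [Nat.add_sub_cancel_left] at hx hy
  calc x.natAbs * y.natAbs ≤ 2 ^ i * 2 ^ j := Nat.mul_le_mul hx.le hy.le
    _ = 2 ^ (i + j) := (pow_add ..).symm
    _ < 2 ^ (i + j + 1) := Nat.pow_lt_pow_right (by norm_num) (by omega)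

theorem bitLen_div (x y : ℤ) : bitLen (x / y) ≤ bitLen x :=
  bitLen_mono (Int.natAbs_ediv_le_natAbs x y)

/-- Every memory cell holds an integer of at most `b` bits. -/
def Mem.Bounded (b : ℕ) (μ : Mem) : Prop := ∀ a, bitLen (μ a) ≤ b

theorem Mem.Bounded.mono {b b' : ℕ} {μ : Mem} (h : μ.Bounded b) (hb : b ≤ b') : μ.Bounded b' :=
  fun a => (h a).trans hb

theorem Mem.Bounded.one_le {b : ℕ} {μ : Mem} (h : μ.Bounded b) : 1 ≤ b :=
  (one_le_bitLen _).trans (h 0)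

/-- The constant depends on the expression only: each operation at most adds the lengths of its
operands, and the schoolbook product of two lengths is where the square comes from. -/
theorem Expr.exists_cost_bound (e : Expr) : ∃ K : ℕ, 1 ≤ K ∧ ∀ (b : ℕ) (μ : Mem), μ.Bounded b →
    bitLen (e.eval μ) ≤ K * b ∧ e.cost μ ≤ K * b ^ 2 := by
  induction e with
  | const c =>
    refine ⟨bitLen c, one_le_bitLen c, fun b μ h => ⟨?_, ?_⟩⟩
    · exact Nat.le_mul_of_pos_right _ h.one_le
    · exact Nat.le_mul_of_pos_right _ (pow_pos h.one_le 2)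
  | mem a iha =>
    obtain ⟨K, hK, h⟩ := iha
    refine ⟨K + K + 1, by omega, fun b μ hb => ?_⟩
    obtain ⟨h1, h2⟩ := h b μ hb
    have hb1 := hb.one_le
    have hb2 : b ≤ b ^ 2 := Nat.le_self_pow (by norm_num) b
    have := hb (a.eval μ)
    simp only [Expr.eval, Expr.cost]
    constructor <;> nlinarith
  | add x y ihx ihy | sub x y ihx ihy =>
    obtain ⟨K, hK, h⟩ := ihx
    obtain ⟨K', hK', h'⟩ := ihy
    refine ⟨2 * K + 2 * K', by omega, fun b μ hb => ?_⟩
    obtain ⟨h1, h2⟩ := h b μ hb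
    obtain ⟨h3, h4⟩ := h' b μ hb
    have hb2 : b ≤ b ^ 2 := Nat.le_self_pow (by norm_num) b
    have e1 := bitLen_add (x.eval μ) (y.eval μ)
    have e2 := bitLen_sub (x.eval μ) (y.eval μ)
    have e3 := Nat.mul_le_mul_left K hb2
    have e4 := Nat.mul_le_mul_left K' hb2
    simp only [Expr.eval, Expr.cost]
    constructor <;> nlinarith
  | mul x y ihx ihy | div x y ihx ihy =>
    obtain ⟨K, hK, h⟩ := ihx
    obtain ⟨K', hK', h'⟩ := ihy
    refine ⟨K + K' + K * K', by nlinarith, fun b μ hb => ?_⟩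
    obtain ⟨h1, h2⟩ := h b μ hb
    obtain ⟨h3, h4⟩ := h' b μ hb
    have e1 := bitLen_mul (x.eval μ) (y.eval μ)
    have e2 := bitLen_div (x.eval μ) (y.eval μ)
    have e3 := Nat.mul_le_mul h1 h3
    have e4 : 0 ≤ K * K' * b := Nat.zero_le _
    simp only [Expr.eval, Expr.cost]
    constructor <;> nlinarith

/-- Programs without loops. -/
def Prog.LoopFree : Prog → Prop
  | .skip => True
  | .assign _ _ => True
  | .seq P Q => P.LoopFree ∧ Q.LoopFree
  | .branch _ P Q => P.LoopFree ∧ Q.LoopFree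
  | .loop _ _ => False

/-- The memory after the run of a loop-free program (loops are ignored). -/
def Prog.run : Prog → Mem → Mem
  | .skip, μ => μ
  | .assign a e, μ => Function.update μ (a.eval μ) (e.eval μ)
  | .seq P Q, μ => Q.run (P.run μ)
  | .branch c P Q, μ => if 0 < c.eval μ then P.run μ else Q.run μ
  | .loop _ _, μ => μ

/-- The bound on the resulting memory is carried along for the induction: in a sequence the second
program starts with cells of `K * b` bits. -/
theorem Prog.LoopFree.exists_cost_bound' {P : Prog} (hP : P.LoopFree) :
    ∃ K : ℕ, 1 ≤ K ∧ ∀ (b : ℕ) (μ : Mem), μ.Bounded b →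
      (P.run μ).Bounded (K * b) ∧ ∃ t, Exec P μ (P.run μ) t ∧ t ≤ K * b ^ 2 := by
  induction P with
  | skip =>
    exact ⟨1, le_rfl, fun b μ h => ⟨by rwa [one_mul], 1, .skip μ,
      by simpa using Nat.one_le_pow _ _ h.one_le⟩⟩
  | assign a e =>
    obtain ⟨K, hK, h⟩ := a.exists_cost_bound
    obtain ⟨K', hK', h'⟩ := e.exists_cost_bound
    refine ⟨2 * K + 2 * K', by omega, fun b μ hb => ?_⟩
    obtain ⟨h1, h2⟩ := h b μ hb
    obtain ⟨h3, h4⟩ := h' b μ hb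
    have hb1 := hb.one_le
    have hb2 : b ≤ b ^ 2 := Nat.le_self_pow (by norm_num) b
    refine ⟨fun c => ?_, _, .assign a e μ, ?_⟩
    · rw [Prog.run, Function.update_apply]
      split_ifs
      · nlinarith
      · have := hb c
        nlinarith
    · have e3 := Nat.mul_le_mul_left K hb2
      have e4 := Nat.mul_le_mul_left K' hb2
      nlinarith
  | seq P Q ihP ihQ =>
    obtain ⟨K, hK, h⟩ := ihP hP.1
    obtain ⟨K', hK', h'⟩ := ihQ hP.2
    refine ⟨K + K' * K ^ 2, by omega, fun b μ hb => ?_⟩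
    obtain ⟨h1, t, h2, ht⟩ := h b μ hb
    obtain ⟨h3, t', h4, ht'⟩ := h' (K * b) _ h1
    refine ⟨h3.mono ?_, _, .seq h2 h4, ?_⟩
    · have : K ≤ K ^ 2 := Nat.le_self_pow (by norm_num) K
      calc K' * (K * b) = (K' * K) * b := by ring
        _ ≤ (K + K' * K ^ 2) * b := Nat.mul_le_mul_right _ (by nlinarith)
    · calc t + t' ≤ K * b ^ 2 + K' * (K * b) ^ 2 := by omega
        _ = _ := by ring
  | branch c P Q ihP ihQ =>
    obtain ⟨K, hK, h⟩ := ihP hP.1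
    obtain ⟨K', hK', h'⟩ := ihQ hP.2
    obtain ⟨K₀, hK₀, h₀⟩ := c.exists_cost_bound
    refine ⟨2 * K₀ + K + K', by omega, fun b μ hb => ?_⟩
    obtain ⟨h1, t, h2, ht⟩ := h b μ hb
    obtain ⟨h3, t', h4, ht'⟩ := h' b μ hb
    obtain ⟨h5, h6⟩ := h₀ b μ hb
    have hb2 : b ≤ b ^ 2 := Nat.le_self_pow (by norm_num) b
    have e3 := Nat.mul_le_mul_left K₀ hb2
    rw [Prog.run]
    split_ifs with hc
    · exact ⟨h1.mono (Nat.mul_le_mul_right _ (by omega)), _, .branch_pos hc h2, by nlinarith⟩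
    · exact ⟨h3.mono (Nat.mul_le_mul_right _ (by omega)), _, .branch_neg hc h4, by nlinarith⟩
  | loop => exact hP.elim

theorem Prog.LoopFree.exists_cost_bound {P : Prog} (hP : P.LoopFree) :
    ∃ K : ℕ, ∀ (b : ℕ) (μ : Mem), μ.Bounded b → ∃ t, Exec P μ (P.run μ) t ∧ t ≤ K * b ^ 2 := by
  obtain ⟨K, _, h⟩ := hP.exists_cost_bound'
  exact ⟨K, fun b μ hb => (h b μ hb).2⟩

/-- A loop whose loop-free body keeps an invariant that bounds all cells and decreases a potential
halts, and its cost is polynomial in the bound and the potential. -/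
theorem Exec.exists_loop_bound (c : Expr) {P : Prog} (hP : P.LoopFree) :
    ∃ K : ℕ, ∀ (b : ℕ) (Inv : Mem → Prop) (Ψ : Mem → ℕ), (∀ μ, Inv μ → μ.Bounded b) →
      (∀ μ, Inv μ → 0 < c.eval μ → Inv (P.run μ) ∧ Ψ (P.run μ) < Ψ μ) →
      ∀ μ, Inv μ → ∃ ν t, Exec (.loop c P) μ ν t ∧ t ≤ K * (Ψ μ + 1) * b ^ 2 ∧ Inv ν ∧
        ¬ 0 < c.eval ν := by
  obtain ⟨K, hK⟩ := hP.exists_cost_bound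
  obtain ⟨K₀, -, hK₀⟩ := c.exists_cost_bound
  refine ⟨2 * K₀ + K, fun b Inv Ψ hInv hstep => ?_⟩
  have hcond : ∀ μ, Inv μ → c.cost μ + bitLen (c.eval μ) ≤ 2 * K₀ * b ^ 2 := fun μ hμ => by
    obtain ⟨h5, h6⟩ := hK₀ b μ (hInv μ hμ)
    have hb2 : b ≤ b ^ 2 := Nat.le_self_pow (by norm_num) b
    have e3 := Nat.mul_le_mul_left K₀ hb2
    nlinarith
  suffices ∀ k μ, Inv μ → Ψ μ ≤ k → ∃ ν t, Exec (.loop c P) μ ν t ∧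
      t ≤ (2 * K₀ + K) * (k + 1) * b ^ 2 ∧ Inv ν ∧ ¬ 0 < c.eval ν from
    fun μ hμ => this _ μ hμ le_rfl
  intro k
  induction k with
  | zero =>
    intro μ hμ hk
    have hc : ¬ 0 < c.eval μ := fun hc => by have := (hstep μ hμ hc).2; omega
    exact ⟨μ, _, .loop_done hc, (hcond μ hμ).trans (by nlinarith [Nat.zero_le (K * b ^ 2)]),
      hμ, hc⟩
  | succ k ih =>
    intro μ hμ hk
    by_cases hc : 0 < c.eval μ
    · obtain ⟨h1, h2⟩ := hstep μ hμ hc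
      obtain ⟨t, ht, htb⟩ := hK b μ (hInv μ hμ)
      obtain ⟨ν, t', ht', htb', hν⟩ := ih _ h1 (by omega)
      refine ⟨ν, _, .loop_step hc ht ht', ?_, hν⟩
      have := hcond μ hμ
      calc _ ≤ 2 * K₀ * b ^ 2 + K * b ^ 2 + (2 * K₀ + K) * (k + 1) * b ^ 2 := by omega
        _ = _ := by ring
    · refine ⟨μ, _, .loop_done hc, (hcond μ hμ).trans ?_, hμ, hc⟩
      exact Nat.mul_le_mul_right _
        (by nlinarith [Nat.zero_le (K * (k + 1 + 1)), Nat.zero_le (K₀ * k)])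

/-! ### The ring of integers of the eighth cyclotomic field -/

/-- The element `c0 + c1 ζ + c2 ζ² + c3 ζ³` of `ℤ[ζ]`, where `ζ ^ 4 = -1`. -/
@[ext]
structure Z8 : Type where
  c0 : ℤ
  c1 : ℤ
  c2 : ℤ
  c3 : ℤ

namespace Z8

instance : Zero Z8 := ⟨⟨0, 0, 0, 0⟩⟩
instance : One Z8 := ⟨⟨1, 0, 0, 0⟩⟩
instance : Add Z8 := ⟨fun a b => ⟨a.c0 + b.c0, a.c1 + b.c1, a.c2 + b.c2, a.c3 + b.c3⟩⟩
instance : Neg Z8 := ⟨fun a => ⟨-a.c0, -a.c1, -a.c2, -a.c3⟩⟩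
instance : Sub Z8 := ⟨fun a b => ⟨a.c0 - b.c0, a.c1 - b.c1, a.c2 - b.c2, a.c3 - b.c3⟩⟩
instance : Mul Z8 := ⟨fun a b =>
  ⟨a.c0 * b.c0 - a.c1 * b.c3 - a.c2 * b.c2 - a.c3 * b.c1,
   a.c0 * b.c1 + a.c1 * b.c0 - a.c2 * b.c3 - a.c3 * b.c2,
   a.c0 * b.c2 + a.c1 * b.c1 + a.c2 * b.c0 - a.c3 * b.c3,
   a.c0 * b.c3 + a.c1 * b.c2 + a.c2 * b.c1 + a.c3 * b.c0⟩⟩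

@[simp] theorem zero_c0 : (0 : Z8).c0 = 0 := rfl
@[simp] theorem zero_c1 : (0 : Z8).c1 = 0 := rfl
@[simp] theorem zero_c2 : (0 : Z8).c2 = 0 := rfl
@[simp] theorem zero_c3 : (0 : Z8).c3 = 0 := rfl
@[simp] theorem one_c0 : (1 : Z8).c0 = 1 := rfl
@[simp] theorem one_c1 : (1 : Z8).c1 = 0 := rfl
@[simp] theorem one_c2 : (1 : Z8).c2 = 0 := rfl
@[simp] theorem one_c3 : (1 : Z8).c3 = 0 := rfl
@[simp] theorem add_c0 (a b : Z8) : (a + b).c0 = a.c0 + b.c0 := rfl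
@[simp] theorem add_c1 (a b : Z8) : (a + b).c1 = a.c1 + b.c1 := rfl
@[simp] theorem add_c2 (a b : Z8) : (a + b).c2 = a.c2 + b.c2 := rfl
@[simp] theorem add_c3 (a b : Z8) : (a + b).c3 = a.c3 + b.c3 := rfl
@[simp] theorem neg_c0 (a : Z8) : (-a).c0 = -a.c0 := rfl
@[simp] theorem neg_c1 (a : Z8) : (-a).c1 = -a.c1 := rfl
@[simp] theorem neg_c2 (a : Z8) : (-a).c2 = -a.c2 := rfl
@[simp] theorem neg_c3 (a : Z8) : (-a).c3 = -a.c3 := rfl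
@[simp] theorem sub_c0 (a b : Z8) : (a - b).c0 = a.c0 - b.c0 := rfl
@[simp] theorem sub_c1 (a b : Z8) : (a - b).c1 = a.c1 - b.c1 := rfl
@[simp] theorem sub_c2 (a b : Z8) : (a - b).c2 = a.c2 - b.c2 := rfl
@[simp] theorem sub_c3 (a b : Z8) : (a - b).c3 = a.c3 - b.c3 := rfl
@[simp] theorem mul_c0 (a b : Z8) :
    (a * b).c0 = a.c0 * b.c0 - a.c1 * b.c3 - a.c2 * b.c2 - a.c3 * b.c1 := rfl
@[simp] theorem mul_c1 (a b : Z8) :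
    (a * b).c1 = a.c0 * b.c1 + a.c1 * b.c0 - a.c2 * b.c3 - a.c3 * b.c2 := rfl
@[simp] theorem mul_c2 (a b : Z8) :
    (a * b).c2 = a.c0 * b.c2 + a.c1 * b.c1 + a.c2 * b.c0 - a.c3 * b.c3 := rfl
@[simp] theorem mul_c3 (a b : Z8) :
    (a * b).c3 = a.c0 * b.c3 + a.c1 * b.c2 + a.c2 * b.c1 + a.c3 * b.c0 := rfl

instance : CommRing Z8 where
  add_assoc a b c := by ext <;> simp <;> ring
  zero_add a := by ext <;> simp
  add_zero a := by ext <;> simp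
  add_comm a b := by ext <;> simp <;> ring
  neg_add_cancel a := by ext <;> simp
  sub_eq_add_neg a b := by ext <;> simp <;> ring
  nsmul := nsmulRec
  zsmul := zsmulRec
  mul_assoc a b c := by ext <;> simp <;> ring
  one_mul a := by ext <;> simp
  mul_one a := by ext <;> simp
  mul_comm a b := by ext <;> simp <;> ring
  left_distrib a b c := by ext <;> simp <;> ring
  right_distrib a b c := by ext <;> simp <;> ring
  zero_mul a := by ext <;> simp
  mul_zero a := by ext <;> simp

/-- The squared Euclidean length of the coefficient vector. -/
def sqLen (z : Z8) : ℤ := z.c0 ^ 2 + z.c1 ^ 2 + z.c2 ^ 2 + z.c3 ^ 2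

/-- The coefficient of `√2` in `z` times its complex conjugate. -/
def cross (z : Z8) : ℤ := z.c0 * z.c1 + z.c1 * z.c2 + z.c2 * z.c3 - z.c3 * z.c0

/-- The absolute norm. -/
def nm (z : Z8) : ℤ := z.sqLen ^ 2 - 2 * z.cross ^ 2

/-- Complex conjugation. -/
def conj (z : Z8) : Z8 := ⟨z.c0, -z.c3, -z.c2, -z.c1⟩

/-- The product of the three other conjugates of `z`. -/
def adj (z : Z8) : Z8 := z.conj * ⟨z.sqLen, -z.cross, 0, z.cross⟩

/-! ### Norm forms of `ℤ[ζ]` -/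

theorem sqLen_mul (z w : Z8) : (z * w).sqLen = z.sqLen * w.sqLen + 2 * z.cross * w.cross := by
  simp [sqLen, cross]; ring

/-- Together with `sqLen_mul`, this is the multiplicativity of `z ↦ z * conj z = sqLen + cross √2`.
-/
theorem cross_mul (z w : Z8) : (z * w).cross = z.sqLen * w.cross + z.cross * w.sqLen := by
  simp [sqLen, cross]; ring

theorem nm_mul (z w : Z8) : (z * w).nm = z.nm * w.nm := by
  simp only [nm, sqLen_mul, cross_mul]; ring

/-- The two squares come from the other intermediate field: they are the real and imaginary parts of
the relative norm to `ℤ[i]`, where `i = ζ ^ 2`. -/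
theorem nm_eq_sq_add_sq (z : Z8) : z.nm =
    (z.c0 ^ 2 - z.c2 ^ 2 + 2 * z.c1 * z.c3) ^ 2 + (2 * z.c0 * z.c2 - z.c1 ^ 2 + z.c3 ^ 2) ^ 2 := by
  simp only [nm, sqLen, cross]; ring

theorem nm_nonneg (z : Z8) : 0 ≤ z.nm := by rw [nm_eq_sq_add_sq]; positivity

theorem sqLen_nonneg (z : Z8) : 0 ≤ z.sqLen := by rw [sqLen]; positivity

theorem sqLen_eq_zero {z : Z8} : z.sqLen = 0 ↔ z = 0 := by
  refine ⟨fun h => ?_, fun h => by simp [h, sqLen]⟩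
  rw [sqLen] at h
  ext <;> simp <;> nlinarith [sq_nonneg z.c0, sq_nonneg z.c1, sq_nonneg z.c2, sq_nonneg z.c3]

theorem sqLen_pos {z : Z8} (h : z ≠ 0) : 0 < z.sqLen :=
  lt_of_le_of_ne z.sqLen_nonneg fun h' => h (sqLen_eq_zero.1 h'.symm)

/-- A zero norm would make `sqLen ^ 2` twice a square, which the irrationality of `√2` allows only
for `sqLen = 0`. -/
theorem nm_eq_zero {z : Z8} : z.nm = 0 ↔ z = 0 := by
  refine ⟨fun h => ?_, fun h => by simp [h, nm, sqLen, cross]⟩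
  have : Zsqrtd.Nonsquare 2 := ⟨fun n h => by
    have h1 : n < 2 := by nlinarith
    interval_cases n <;> omega⟩
  refine sqLen_eq_zero.1 (Zsqrtd.divides_sq_eq_zero_z (d := 2) (y := z.cross) ?_).1
  rw [nm] at h
  push_cast
  linarith

theorem nm_pos {z : Z8} (h : z ≠ 0) : 0 < z.nm :=
  lt_of_le_of_ne z.nm_nonneg fun h' => h (nm_eq_zero.1 h'.symm)

theorem nm_conj (z : Z8) : z.conj.nm = z.nm := by
  simp only [nm, sqLen, cross, conj]; ring

theorem nm_adj (z : Z8) : z.adj.nm = z.nm ^ 3 := by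
  rw [adj, nm_mul, nm_conj]
  simp only [nm, sqLen, cross]; ring

theorem mul_adj (z : Z8) : z * z.adj = ⟨z.nm, 0, 0, 0⟩ := by
  ext <;> simp [adj, conj, nm, sqLen, cross] <;> ring

/-- An element that cannot be shortened by the fundamental unit is shortest among its multiples. -/
theorem sqLen_le_sqLen_mul {z w : Z8} (hz : 4 * z.cross ^ 2 ≤ z.sqLen ^ 2) (hw : w ≠ 0) :
    z.sqLen ≤ (z * w).sqLen := by
  have h1 := nm_pos hw
  have h2 := sqLen_pos hw
  have h3 := z.sqLen_nonneg
  rw [nm] at h1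
  rw [sqLen_mul]
  -- Positivity of `nm w` gives the strict inequality; between integers it means a gap of at least
  -- `1`, by which `z.sqLen` is multiplied at the end.
  have h4 : |w.cross| < w.sqLen := by
    apply abs_lt_of_sq_lt_sq _ h2.le
    nlinarith [sq_nonneg w.cross]
  have h5 : |2 * z.cross| ≤ z.sqLen := abs_le_of_sq_le_sq (by linarith) h3
  have h6 : |2 * z.cross * w.cross| ≤ z.sqLen * |w.cross| := by
    rw [abs_mul]; exact mul_le_mul_of_nonneg_right h5 (abs_nonneg _)
  have h7 := neg_abs_le (2 * z.cross * w.cross)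
  nlinarith

/-! #### Division with remainder -/

/-- The integer nearest to `c / D`. -/
def rnd (c D : ℤ) : ℤ := (2 * c + D) / (2 * D)

theorem abs_sub_rnd {c D : ℤ} (hD : 0 < D) : |2 * (c - rnd c D * D)| ≤ D := by
  have h1 := Int.emod_add_mul_ediv (2 * c + D) (2 * D)
  have h2 := Int.emod_nonneg (2 * c + D) (b := 2 * D) (by omega)
  have h3 := Int.emod_lt_of_pos (2 * c + D) (b := 2 * D) (by omega)
  rw [rnd, abs_le]
  constructor <;> nlinarith

/-- The coordinatewise rounded quotient. -/
def quo (a b : Z8) : Z8 :=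
  ⟨rnd (a * b.adj).c0 b.nm, rnd (a * b.adj).c1 b.nm, rnd (a * b.adj).c2 b.nm,
    rnd (a * b.adj).c3 b.nm⟩

/-- The remainder of the division with coordinatewise rounding. -/
def rem (a b : Z8) : Z8 := a - quo a b * b

/-- All coefficients of `z` are at most `X` in absolute value. -/
def Le (z : Z8) (X : ℤ) : Prop := |z.c0| ≤ X ∧ |z.c1| ≤ X ∧ |z.c2| ≤ X ∧ |z.c3| ≤ X

/-- On the unit interval `(1 - a²)(1 - b²) ≥ 0` gives `a² + b² - 1 ≤ a² b² ≤ a b`. The only term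
that can hurt is `w (r - p)`, which is nonnegative or at least `r - p`. -/
theorem cross_lower_bound_of_nonneg {p q r w : ℝ} (hp : 0 ≤ p) (hq : 0 ≤ q) (hr : 0 ≤ r)
    (hw : 0 ≤ w) (hp1 : p ≤ 1) (hq1 : q ≤ 1) (hr1 : r ≤ 1) (hw1 : w ≤ 1) :
    2 * (p ^ 2 + q ^ 2 + r ^ 2 + w ^ 2 - 3) ≤ p * q + q * r + r * w - w * p := by
  have key : ∀ {a b : ℝ}, 0 ≤ a → a ≤ 1 → 0 ≤ b → b ≤ 1 → a ^ 2 + b ^ 2 - 1 ≤ a * b := by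
    intro a b ha ha1 hb hb1
    have h1 : a ^ 2 ≤ 1 := pow_le_one₀ ha ha1
    have h2 : b ^ 2 ≤ 1 := pow_le_one₀ hb hb1
    have h3 : a * b ≤ 1 := mul_le_one₀ ha1 hb hb1
    have h4 : 0 ≤ a * b := mul_nonneg ha hb
    nlinarith [mul_nonneg (sub_nonneg.2 h1) (sub_nonneg.2 h2)]
  have hp2 : p ^ 2 ≤ 1 := pow_le_one₀ hp hp1
  have hq2 : q ^ 2 ≤ 1 := pow_le_one₀ hq hq1
  have hr2 : r ^ 2 ≤ 1 := pow_le_one₀ hr hr1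
  have hw2 : w ^ 2 ≤ 1 := pow_le_one₀ hw hw1
  have hqr := key hq hq1 hr hr1
  rcases le_total p r with h | h
  · have hpq := key hp hp1 hq hq1
    nlinarith [mul_nonneg hw (sub_nonneg.2 h)]
  · have h5 : r - p ≤ w * (r - p) := by nlinarith
    have h6 : p * (1 - q) ≤ 1 - q := by nlinarith
    have h7 : q ^ 2 ≤ q := by nlinarith
    have h8 : r ^ 2 ≤ r := by nlinarith
    nlinarith

/-- The trivial bound on the square of the sum of squares is `16`, which would not give a Euclidean
division. When the sum of squares exceeds `3`, however, the cross term must be large as well. -/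
theorem norm_form_le {e f g h : ℝ} (he : |e| ≤ 1) (hf : |f| ≤ 1) (hg : |g| ≤ 1) (hh : |h| ≤ 1) :
    (e ^ 2 + f ^ 2 + g ^ 2 + h ^ 2) ^ 2 - 2 * (e * f + f * g + g * h - h * e) ^ 2 ≤ 11 := by
  have main : e ^ 2 + f ^ 2 + g ^ 2 + h ^ 2 ≤ 3 ∨
      2 * (e ^ 2 + f ^ 2 + g ^ 2 + h ^ 2 - 3) ≤ |e * f + f * g + g * h - h * e| := by
    right
    have b1 := abs_le.1 he
    have b2 := abs_le.1 hf
    have b3 := abs_le.1 hg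
    have b4 := abs_le.1 hh
    rw [le_abs]
    have L := fun (p q r w : ℝ) a1 a2 a3 a4 a5 a6 a7 a8 =>
      @cross_lower_bound_of_nonneg p q r w a1 a2 a3 a4 a5 a6 a7 a8
    -- The product of `e f`, `f g`, `g h`, `-h e` is `-(e f g h)²`. So, up to a global sign and
    -- zeros, exactly one of the four terms is negative, and the cyclic shifts cover its four
    -- positions.
    have A1 := L |e| |f| |g| |h| (abs_nonneg _) (abs_nonneg _) (abs_nonneg _) (abs_nonneg _)
      he hf hg hh
    have A2 := L |f| |g| |h| |e| (abs_nonneg _) (abs_nonneg _) (abs_nonneg _) (abs_nonneg _)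
      hf hg hh he
    have A3 := L |g| |h| |e| |f| (abs_nonneg _) (abs_nonneg _) (abs_nonneg _) (abs_nonneg _)
      hg hh he hf
    have A4 := L |h| |e| |f| |g| (abs_nonneg _) (abs_nonneg _) (abs_nonneg _) (abs_nonneg _)
      hh he hf hg
    simp only [sq_abs] at A1 A2 A3 A4
    rcases abs_cases e with ⟨h1, -⟩ | ⟨h1, -⟩ <;> rcases abs_cases f with ⟨h2, -⟩ | ⟨h2, -⟩ <;>
    rcases abs_cases g with ⟨h3, -⟩ | ⟨h3, -⟩ <;> rcases abs_cases h with ⟨h4, -⟩ | ⟨h4, -⟩ <;>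
    rw [h1, h2, h3, h4] at A1 A2 A3 A4 <;>
    first
      | (left; linarith only [A1]) | (left; linarith only [A2]) | (left; linarith only [A3])
      | (left; linarith only [A4]) | (right; linarith only [A1]) | (right; linarith only [A2])
      | (right; linarith only [A3]) | (right; linarith only [A4])
  set s := e ^ 2 + f ^ 2 + g ^ 2 + h ^ 2 with hs
  set t := e * f + f * g + g * h - h * e
  have hs0 : 0 ≤ s := by positivity
  by_cases h3 : s ≤ 3
  · nlinarith [sq_nonneg t]
  · have h4 : 2 * (s - 3) ≤ |t| := main.resolve_left h3
    have h5 : (2 * (s - 3)) ^ 2 ≤ |t| ^ 2 := by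
      apply pow_le_pow_left₀ _ h4; linarith
    rw [sq_abs] at h5
    -- `s² - 8 (s - 3)² = 72/7 - 7 (s - 24/7)²`, and `72/7 < 11`.
    nlinarith [sq_nonneg (s - 24 / 7)]

theorem nm_le_of_le {z : Z8} {D : ℤ} (hD : 0 < D) (h0 : |2 * z.c0| ≤ D) (h1 : |2 * z.c1| ≤ D)
    (h2 : |2 * z.c2| ≤ D) (h3 : |2 * z.c3| ≤ D) : 16 * z.nm ≤ 11 * D ^ 4 := by
  have hD' : (0 : ℝ) < D := by exact_mod_cast hD
  have key : ∀ c : ℤ, |2 * c| ≤ D → |2 * (c : ℝ) / D| ≤ 1 := by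
    intro c hc
    rw [abs_div, abs_of_pos hD', div_le_one hD']
    exact_mod_cast hc
  have := norm_form_le (key _ h0) (key _ h1) (key _ h2) (key _ h3)
  have e : (16 * z.nm : ℝ) = D ^ 4 * (((2 * (z.c0 : ℝ) / D) ^ 2 + (2 * (z.c1 : ℝ) / D) ^ 2 +
      (2 * (z.c2 : ℝ) / D) ^ 2 + (2 * (z.c3 : ℝ) / D) ^ 2) ^ 2 -
      2 * ((2 * (z.c0 : ℝ) / D) * (2 * (z.c1 : ℝ) / D) + (2 * (z.c1 : ℝ) / D) *
      (2 * (z.c2 : ℝ) / D) + (2 * (z.c2 : ℝ) / D) * (2 * (z.c3 : ℝ) / D) -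
      (2 * (z.c3 : ℝ) / D) * (2 * (z.c0 : ℝ) / D)) ^ 2) := by
    simp only [nm, sqLen, cross]
    push_cast
    field_simp
    ring
  have h : (16 * z.nm : ℝ) ≤ 11 * D ^ 4 := by
    rw [e]
    nlinarith [pow_pos hD' 4]
  exact_mod_cast h

theorem mul_scalar (z : Z8) (d : ℤ) :
    z * ⟨d, 0, 0, 0⟩ = ⟨z.c0 * d, z.c1 * d, z.c2 * d, z.c3 * d⟩ := by
  ext <;> simp

theorem rem_mul_adj (a b : Z8) : rem a b * b.adj = a * b.adj - quo a b * ⟨b.nm, 0, 0, 0⟩ := by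
  rw [rem, sub_mul, mul_assoc, mul_adj]

theorem abs_rem_mul_adj {b : Z8} (a : Z8) (hb : b ≠ 0) :
    |2 * (rem a b * b.adj).c0| ≤ b.nm ∧ |2 * (rem a b * b.adj).c1| ≤ b.nm ∧
    |2 * (rem a b * b.adj).c2| ≤ b.nm ∧ |2 * (rem a b * b.adj).c3| ≤ b.nm := by
  have h := fun c => abs_sub_rnd (c := c) (nm_pos hb)
  rw [rem_mul_adj, mul_scalar]
  exact ⟨h _, h _, h _, h _⟩

/-- The product `rem a b * b.adj` is `b.nm` times the quotient `rem a b / b`, whose coefficients are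
at most `1/2`; its norm is `nm (rem a b) * b.nm ^ 3`, and `norm_form_le` applies after scaling. -/
theorem nm_rem_le (a : Z8) {b : Z8} (hb : b ≠ 0) : 16 * (rem a b).nm ≤ 11 * b.nm := by
  obtain ⟨h0, h1, h2, h3⟩ := abs_rem_mul_adj a hb
  have h := nm_le_of_le (nm_pos hb) h0 h1 h2 h3
  rw [nm_mul, nm_adj] at h
  have := pow_pos (nm_pos hb) 3
  refine le_of_mul_le_mul_right ?_ this
  linarith

theorem Le.mul {z w : Z8} {X Y : ℤ} (hz : z.Le X) (hw : w.Le Y) : (z * w).Le (4 * (X * Y)) := by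
  obtain ⟨a0, a1, a2, a3⟩ := hz
  obtain ⟨b0, b1, b2, b3⟩ := hw
  have key : ∀ {x y : ℤ}, |x| ≤ X → |y| ≤ Y → -(X * Y) ≤ x * y ∧ x * y ≤ X * Y := by
    intro x y hx hy
    rw [← abs_le, abs_mul]
    exact mul_le_mul hx hy (abs_nonneg _) ((abs_nonneg _).trans hx)
  refine ⟨?_, ?_, ?_, ?_⟩ <;> rw [abs_le] <;>
    simp only [mul_c0, mul_c1, mul_c2, mul_c3]
  · have := key a0 b0; have := key a1 b3; have := key a2 b2; have := key a3 b1
    constructor <;> linarith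
  · have := key a0 b1; have := key a1 b0; have := key a2 b3; have := key a3 b2
    constructor <;> linarith
  · have := key a0 b2; have := key a1 b1; have := key a2 b0; have := key a3 b3
    constructor <;> linarith
  · have := key a0 b3; have := key a1 b2; have := key a2 b1; have := key a3 b0
    constructor <;> linarith

/-- Controls coefficients and not just the norm, which units leave unchanged. The remainder is `b`
times an element with coefficients at most `1/2`, and each coefficient of a product is a sum of four
terms: `4 * (1/2) * X`. -/
theorem Le.rem {b : Z8} {X : ℤ} (hX : b.Le X) (hb : b ≠ 0) (a : Z8) : (rem a b).Le (2 * X) := by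
  obtain ⟨h0, h1, h2, h3⟩ := abs_rem_mul_adj a hb
  have hD := nm_pos hb
  have e : Z8.rem a b * b.adj * b = Z8.rem a b * ⟨b.nm, 0, 0, 0⟩ := by
    rw [mul_assoc, mul_comm b.adj, mul_adj]
  have h := Le.mul (z := Z8.rem a b * b.adj + Z8.rem a b * b.adj) (X := b.nm) (w := b)
    ⟨by simpa only [add_c0, two_mul] using h0, by simpa only [add_c1, two_mul] using h1,
     by simpa only [add_c2, two_mul] using h2, by simpa only [add_c3, two_mul] using h3⟩ hX
  rw [add_mul, e] at h
  have key : ∀ {x : ℤ}, |x * b.nm + x * b.nm| ≤ 4 * (b.nm * X) → |x| ≤ 2 * X := by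
    intro x hx
    rw [← two_mul, abs_mul, abs_mul, abs_of_pos hD, abs_two] at hx
    refine le_of_mul_le_mul_right ?_ hD
    linarith
  obtain ⟨g0, g1, g2, g3⟩ := h
  simp only [add_c0, add_c1, add_c2, add_c3, mul_c0, mul_c1, mul_c2, mul_c3, mul_zero, sub_zero,
    zero_add, add_zero] at g0 g1 g2 g3
  exact ⟨key g0, key g1, key g2, key g3⟩

theorem rnd_zero {D : ℤ} (hD : 0 < D) : rnd 0 D = 0 := by
  rw [rnd]
  exact Int.ediv_eq_zero_of_lt (by omega) (by omega)

/-- The Euclidean algorithm stays inside `ℤ[i]`, since a zero coefficient is rounded to zero. This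
is what makes it usable for `n = 1`. -/
theorem rem_even {a b : Z8} (hb : b ≠ 0) (ha1 : a.c1 = 0) (ha3 : a.c3 = 0) (hb1 : b.c1 = 0)
    (hb3 : b.c3 = 0) : (rem a b).c1 = 0 ∧ (rem a b).c3 = 0 := by
  have h1 : (a * b.adj).c1 = 0 := by simp [adj, conj, cross, ha1, ha3, hb1, hb3]
  have h3 : (a * b.adj).c3 = 0 := by simp [adj, conj, cross, ha1, ha3, hb1, hb3]
  have := rnd_zero (nm_pos hb)
  constructor <;> simp [rem, quo, h1, h3, this, ha1, ha3, hb1, hb3]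

/-! #### Reduction by the fundamental unit -/

/-- Since `ζ - ζ³ = √2`, the factor is `√2 - 1`. It is real, so `sqLen + cross √2` is multiplied by
its square `3 - 2 √2`. -/
theorem sqLen_sub_mul_cross (z : Z8) : (z * ⟨-1, 1, 0, -1⟩).sqLen = 3 * z.sqLen - 4 * z.cross := by
  simp [sqLen_mul]; simp [sqLen, cross]; ring

theorem cross_sub_mul_sqLen (z : Z8) : (z * ⟨-1, 1, 0, -1⟩).cross = 3 * z.cross - 2 * z.sqLen := by
  simp [cross_mul]; simp [sqLen, cross]; ring

theorem sqLen_add_mul_cross (z : Z8) : (z * ⟨1, 1, 0, -1⟩).sqLen = 3 * z.sqLen + 4 * z.cross := by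
  simp [sqLen_mul]; simp [sqLen, cross]; ring

theorem cross_add_mul_sqLen (z : Z8) : (z * ⟨1, 1, 0, -1⟩).cross = 3 * z.cross + 2 * z.sqLen := by
  simp [cross_mul]; simp [sqLen, cross]; ring

/-- One step of the reduction: multiply by `√2 - 1` or `√2 + 1`. -/
def unitStep (z : Z8) : Z8 := z * if 0 < z.cross then ⟨-1, 1, 0, -1⟩ else ⟨1, 1, 0, -1⟩

theorem unitStep_isUnit (z : Z8) : ∃ u v : Z8, unitStep z = z * u ∧ u * v = 1 := by
  rw [unitStep]
  split_ifs
  · exact ⟨_, ⟨1, 1, 0, -1⟩, rfl, by ext <;> simp⟩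
  · exact ⟨_, ⟨-1, 1, 0, -1⟩, rfl, by ext <;> simp⟩

/-- Take `c > 0`, so `s < 2 c`. The new pair is `(3 s - 4 c, 3 c - 2 s)`. If `3 c ≤ 2 s` it is
already reduced; otherwise `3 (3 s - 4 c) ≤ s`. So every step but the last divides the squared
length by at least `3`. -/
theorem unitStep_reduced_or {z : Z8} (hz : 0 < 4 * z.cross * z.cross - z.sqLen * z.sqLen) :
    (unitStep z).sqLen ≤ z.sqLen ∧
    (¬ 0 < 4 * (unitStep z).cross * (unitStep z).cross -
      (unitStep z).sqLen * (unitStep z).sqLen ∨ 3 * (unitStep z).sqLen ≤ z.sqLen) := by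
  have h1 := z.nm_nonneg
  have h2 := z.sqLen_nonneg
  have h0 := (unitStep z).sqLen_nonneg
  rw [nm] at h1
  rw [unitStep] at h0 ⊢
  split_ifs at h0 ⊢ with h
  · rw [sqLen_sub_mul_cross] at *
    rw [cross_sub_mul_sqLen]
    have h3 : z.sqLen ≤ 2 * z.cross := by
      apply le_of_not_gt; intro h'; nlinarith
    refine ⟨by linarith, ?_⟩
    rcases le_total (3 * z.cross) (2 * z.sqLen) with h4 | h4
    · left; nlinarith
    · right; linarith
  · rw [sqLen_add_mul_cross] at *
    rw [cross_add_mul_sqLen]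
    have h3 : z.sqLen ≤ -(2 * z.cross) := by
      apply le_of_not_gt; intro h'; nlinarith
    refine ⟨by linarith, ?_⟩
    rcases le_total (-(3 * z.cross)) (2 * z.sqLen) with h4 | h4
    · left; nlinarith
    · right; linarith

/-- For `n = 1` the unit `√2 - 1` is not available in the ring; the reduction loop does not run
there, because elements of `ℤ[i]` have `cross = 0`. -/
theorem not_shortened_of_even {z : Z8} (hz : 0 < 4 * z.cross * z.cross - z.sqLen * z.sqLen)
    (h1 : z.c1 = 0) (h3 : z.c3 = 0) : False := by
  have : z.cross = 0 := by simp [cross, h1, h3]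
  rw [this] at hz
  nlinarith [mul_self_nonneg z.sqLen]

theorem le_sqLen (z : Z8) : z.Le z.sqLen := by
  have key : ∀ x : ℤ, |x| ≤ x ^ 2 := fun x => by
    rw [← sq_abs]
    nlinarith [abs_nonneg x, Int.le_self_sq |x|]
  have k0 := key z.c0
  have k1 := key z.c1
  have k2 := key z.c2
  have k3 := key z.c3
  have := sq_nonneg z.c0
  have := sq_nonneg z.c1
  have := sq_nonneg z.c2
  have := sq_nonneg z.c3
  simp only [Le, sqLen]
  refine ⟨?_, ?_, ?_, ?_⟩ <;> linarith

theorem Le.sqLen_le {z : Z8} {X : ℤ} (h : z.Le X) : z.sqLen ≤ 4 * X ^ 2 := by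
  obtain ⟨h0, h1, h2, h3⟩ := h
  have := sq_le_sq' (abs_le.1 h0).1 (abs_le.1 h0).2
  have := sq_le_sq' (abs_le.1 h1).1 (abs_le.1 h1).2
  have := sq_le_sq' (abs_le.1 h2).1 (abs_le.1 h2).2
  have := sq_le_sq' (abs_le.1 h3).1 (abs_le.1 h3).2
  rw [sqLen]
  linarith

theorem nm_le_sqLen_sq (z : Z8) : z.nm ≤ z.sqLen ^ 2 := by
  rw [nm]; nlinarith [sq_nonneg z.cross]

end Z8

/-! ### The program -/

/-- The cell with the fixed address `a`. -/
abbrev Expr.var (a : ℤ) : Expr := .mem (.const a)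

/-- Store a value in the cell with the fixed address `a`. -/
abbrev Prog.set (a : ℤ) (e : Expr) : Prog := .assign (.const a) e

/-- Four expressions, for the coefficients of an element of `Z8`. -/
structure Expr8 : Type where
  c0 : Expr
  c1 : Expr
  c2 : Expr
  c3 : Expr

namespace Expr8

def eval (μ : Mem) (x : Expr8) : Z8 := ⟨x.c0.eval μ, x.c1.eval μ, x.c2.eval μ, x.c3.eval μ⟩

def ofZ8 (z : Z8) : Expr8 := ⟨.const z.c0, .const z.c1, .const z.c2, .const z.c3⟩

/-- The element stored in the cells `a`, `a - 1`, `a - 2`, `a - 3`. -/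
def var (a : ℤ) : Expr8 := ⟨.var a, .var (a - 1), .var (a - 2), .var (a - 3)⟩

def mul (x y : Expr8) : Expr8 :=
  ⟨.sub (.sub (.sub (.mul x.c0 y.c0) (.mul x.c1 y.c3)) (.mul x.c2 y.c2)) (.mul x.c3 y.c1),
   .sub (.sub (.add (.mul x.c0 y.c1) (.mul x.c1 y.c0)) (.mul x.c2 y.c3)) (.mul x.c3 y.c2),
   .sub (.add (.add (.mul x.c0 y.c2) (.mul x.c1 y.c1)) (.mul x.c2 y.c0)) (.mul x.c3 y.c3),
   .add (.add (.add (.mul x.c0 y.c3) (.mul x.c1 y.c2)) (.mul x.c2 y.c1)) (.mul x.c3 y.c0)⟩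

def sub (x y : Expr8) : Expr8 :=
  ⟨.sub x.c0 y.c0, .sub x.c1 y.c1, .sub x.c2 y.c2, .sub x.c3 y.c3⟩

def sqLen (x : Expr8) : Expr :=
  .add (.add (.add (.mul x.c0 x.c0) (.mul x.c1 x.c1)) (.mul x.c2 x.c2)) (.mul x.c3 x.c3)

def cross (x : Expr8) : Expr :=
  .sub (.add (.add (.mul x.c0 x.c1) (.mul x.c1 x.c2)) (.mul x.c2 x.c3)) (.mul x.c3 x.c0)

def nm (x : Expr8) : Expr :=
  .sub (.mul x.sqLen x.sqLen) (.mul (.const 2) (.mul x.cross x.cross))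

def neg (e : Expr) : Expr := .sub (.const 0) e

def conj (x : Expr8) : Expr8 := ⟨x.c0, neg x.c3, neg x.c2, neg x.c1⟩

def adj (x : Expr8) : Expr8 := x.conj.mul ⟨x.sqLen, neg x.cross, .const 0, x.cross⟩

def rnd (c D : Expr) : Expr := .div (.add (.mul (.const 2) c) D) (.mul (.const 2) D)

def quo (x y : Expr8) : Expr8 :=
  ⟨rnd (x.mul y.adj).c0 y.nm, rnd (x.mul y.adj).c1 y.nm, rnd (x.mul y.adj).c2 y.nm,
    rnd (x.mul y.adj).c3 y.nm⟩

def rem (x y : Expr8) : Expr8 := x.sub ((quo x y).mul y)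

theorem eval_ofZ8 (μ : Mem) (z : Z8) : (ofZ8 z).eval μ = z := rfl

theorem eval_mul (μ : Mem) (x y : Expr8) : (x.mul y).eval μ = x.eval μ * y.eval μ := rfl

theorem eval_sub (μ : Mem) (x y : Expr8) : (x.sub y).eval μ = x.eval μ - y.eval μ := rfl

theorem eval_sqLen (μ : Mem) (x : Expr8) : x.sqLen.eval μ = (x.eval μ).sqLen := by
  simp only [sqLen, Expr.eval, Z8.sqLen, eval]; ring

theorem eval_cross (μ : Mem) (x : Expr8) : x.cross.eval μ = (x.eval μ).cross := rfl

theorem eval_nm (μ : Mem) (x : Expr8) : x.nm.eval μ = (x.eval μ).nm := by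
  simp only [nm, Expr.eval, Z8.nm, eval_sqLen, eval_cross]; ring

theorem eval_neg (μ : Mem) (e : Expr) : (neg e).eval μ = -e.eval μ := by
  simp [neg, Expr.eval]

theorem eval_adj (μ : Mem) (x : Expr8) : x.adj.eval μ = (x.eval μ).adj := by
  rw [adj, eval_mul, Z8.adj]
  congr 1
  · simp [conj, Z8.conj, eval, eval_neg]
  · simp only [eval, eval_neg, Expr.eval, eval_sqLen, eval_cross]

theorem eval_quo (μ : Mem) (x y : Expr8) : (quo x y).eval μ = (x.eval μ).quo (y.eval μ) := by
  rw [Z8.quo, ← eval_adj, ← eval_mul, ← eval_nm]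
  rfl

theorem eval_rem (μ : Mem) (x y : Expr8) : (rem x y).eval μ = (x.eval μ).rem (y.eval μ) := by
  rw [rem, eval_sub, eval_mul, eval_quo, Z8.rem]

end Expr8

/-- The element of `Z8` stored in the cells `a`, `a - 1`, `a - 2`, `a - 3`. -/
def Mem.get8 (μ : Mem) (a : ℤ) : Z8 := ⟨μ a, μ (a - 1), μ (a - 2), μ (a - 3)⟩

/-- The memory with `z` stored in the cells `a`, `a - 1`, `a - 2`, `a - 3`. -/
def Mem.set8 (μ : Mem) (a : ℤ) (z : Z8) : Mem := fun c =>
  if c = a then z.c0 else if c = a - 1 then z.c1 else if c = a - 2 then z.c2 else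
    if c = a - 3 then z.c3 else μ c

theorem Mem.get8_set8_self (μ : Mem) (a : ℤ) (z : Z8) : (μ.set8 a z).get8 a = z := by
  simp [Mem.get8, Mem.set8]

theorem Mem.set8_of_notMem {μ : Mem} {a c : ℤ} {z : Z8} (h : a < c ∨ c < a - 3) :
    μ.set8 a z c = μ c := by
  rw [Mem.set8, if_neg, if_neg, if_neg, if_neg] <;> omega

theorem Mem.get8_set8_of_disjoint {μ : Mem} {a c : ℤ} {z : Z8} (h : a < c - 3 ∨ c < a - 3) :
    (μ.set8 a z).get8 c = μ.get8 c := by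
  simp only [Mem.get8]
  rw [Mem.set8_of_notMem, Mem.set8_of_notMem, Mem.set8_of_notMem, Mem.set8_of_notMem] <;> omega

theorem Mem.abs_set8_le {μ : Mem} {a c X : ℤ} {z : Z8} (hz : z.Le X) (hμ : |μ c| ≤ X) :
    |μ.set8 a z c| ≤ X := by
  obtain ⟨h0, h1, h2, h3⟩ := hz
  rw [Mem.set8]
  split_ifs <;> assumption

theorem Expr8.eval_var (μ : Mem) (a : ℤ) : (Expr8.var a).eval μ = μ.get8 a := rfl

/-- Store an element of `Z8` in the cells `a`, `a - 1`, `a - 2`, `a - 3`. -/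
def Prog.set8 (a : ℤ) (x : Expr8) : Prog :=
  .seq (.set a x.c0) (.seq (.set (a - 1) x.c1) (.seq (.set (a - 2) x.c2) (.set (a - 3) x.c3)))

theorem Prog.set8_loopFree (a : ℤ) (x : Expr8) : (Prog.set8 a x).LoopFree :=
  ⟨trivial, trivial, trivial, trivial⟩

/-- Four successive assignments amount to a simultaneous one if the expression does not read the
cells being overwritten. This is why remainders and unit multiples pass through `tmpCell`. -/
theorem Prog.run_set8 {a : ℤ} {x : Expr8} {μ : Mem}
    (h : ∀ μ' : Mem, (∀ c, a < c ∨ c < a - 3 → μ' c = μ c) → x.eval μ' = x.eval μ) :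
    (Prog.set8 a x).run μ = μ.set8 a (x.eval μ) := by
  have h0 := h μ fun _ _ => rfl
  set μ₁ := Function.update μ a (x.c0.eval μ) with hμ₁
  have h1 := congrArg Z8.c1 <| h μ₁ fun c hc => by
    rw [hμ₁, Function.update_of_ne (by omega)]
  set μ₂ := Function.update μ₁ (a - 1) (x.c1.eval μ₁) with hμ₂
  have h2 := congrArg Z8.c2 <| h μ₂ fun c hc => by
    rw [hμ₂, Function.update_of_ne (by omega), hμ₁, Function.update_of_ne (by omega)]
  set μ₃ := Function.update μ₂ (a - 2) (x.c2.eval μ₂) with hμ₃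
  have h3 := congrArg Z8.c3 <| h μ₃ fun c hc => by
    rw [hμ₃, Function.update_of_ne (by omega), hμ₂, Function.update_of_ne (by omega), hμ₁,
      Function.update_of_ne (by omega)]
  simp only [Expr8.eval] at h1 h2 h3
  simp only [Prog.set8, Prog.run, Expr.eval]
  rw [← hμ₁, ← hμ₂, ← hμ₃]
  ext c
  rw [h3, hμ₃, h2, hμ₂, h1, hμ₁]
  simp only [Mem.set8, Function.update_apply, Expr8.eval]
  split_ifs <;> first | rfl | omega

-- Address of the dimension.
notation "dimCell" => (-1 : ℤ)
-- Address of a loop counter.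
notation "cntCell" => (-2 : ℤ)
-- Address of the number of quadruples in the input.
notation "numCell" => (-3 : ℤ)
-- Address of the number of quadruples that have been read.
notation "idxCell" => (-4 : ℤ)
-- Address of the first operand of the Euclidean algorithm, which becomes the generator.
notation "genCell" => (-5 : ℤ)
-- Address of the second operand of the Euclidean algorithm.
notation "divCell" => (-9 : ℤ)
-- Address of a temporary element.
notation "tmpCell" => (-13 : ℤ)

/-- `2 ^ n / 4` for `n ≥ 2` and `1` for `n = 1`. -/
def quarterE : Expr := .add (.div (.var dimCell) (.const 4)) (.div (.const 2) (.var dimCell))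

/-- `1` for `n ≥ 2` and `0` for `n = 1`. -/
def oddE : Expr := .sub (.const 1) (.div (.const 2) (.var dimCell))

/-- Quadruple `i` belongs to generator `i / q` and starts at coefficient `i mod q`; the offset `2`
skips the two header cells of the input. -/
def baseE : Expr :=
  .add (.add (.const 2) (.mul (.div (.var idxCell) quarterE) (.var dimCell)))
    (.sub (.var idxCell) (.mul (.div (.var idxCell) quarterE) quarterE))

/-- The quadruple of input coefficients with the number in `idxCell`. -/
def quadE : Expr8 :=
  ⟨.mem baseE,
   .mul oddE (.mem (.add baseE (.div (.var dimCell) (.const 4)))),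
   .mem (.add baseE (.div (.var dimCell) (.const 2))),
   .mul oddE (.mem (.add (.add baseE (.div (.var dimCell) (.const 2)))
    (.div (.var dimCell) (.const 4))))⟩

/-- The quadruple with number `i` of the input `f` in dimension `N`. -/
def quad (f : ℤ → ℤ) (N i : ℤ) : Z8 :=
  let w := N / 4 + 2 / N
  let b := 2 + i / w * N + (i - i / w * w)
  ⟨f b, (1 - 2 / N) * f (b + N / 4), f (b + N / 2), (1 - 2 / N) * f (b + N / 2 + N / 4)⟩

theorem eval_quadE (μ : Mem) : quadE.eval μ = quad μ (μ dimCell) (μ idxCell) := rfl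

/-- Compute the dimension. -/
def dimBody : Prog :=
  .seq (.set dimCell (.add (.var dimCell) (.var dimCell)))
    (.set cntCell (.sub (.var cntCell) (.const 1)))

def dimInit : Prog := .seq (.set cntCell (.var 0)) (.set dimCell (.const 1))

def numInit : Prog := .set numCell (.mul (.var 1) quarterE)

/-- Continue while there are quadruples to be read or the second operand is not zero. -/
def gcdCond : Expr :=
  .add (.sub (.var numCell) (.var idxCell)) (Expr8.var divCell).sqLen

/-- A step of the Euclidean algorithm, or, if it has ended, the next quadruple is read. -/
def gcdBody : Prog :=
  .branch (Expr8.var divCell).sqLen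
    (.seq (.set8 tmpCell (Expr8.rem (.var genCell) (.var divCell)))
      (.seq (.set8 genCell (.var divCell)) (.set8 divCell (.var tmpCell))))
    (.seq (.set8 divCell quadE) (.set idxCell (.add (.var idxCell) (.const 1))))

def unitCond : Expr :=
  .sub (.mul (.mul (.const 4) (Expr8.var genCell).cross) (Expr8.var genCell).cross)
    (.mul (Expr8.var genCell).sqLen (Expr8.var genCell).sqLen)

/-- Multiply by `√2 - 1` or by `√2 + 1`. -/
def unitBody : Prog :=
  .seq (.branch (Expr8.var genCell).cross
      (.set8 tmpCell ((Expr8.var genCell).mul (.ofZ8 ⟨-1, 1, 0, -1⟩)))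
      (.set8 tmpCell ((Expr8.var genCell).mul (.ofZ8 ⟨1, 1, 0, -1⟩))))
    (.set8 genCell (.var tmpCell))

def clearInit : Prog := .set cntCell (.var dimCell)

/-- Clear the output cells. -/
def clearBody : Prog :=
  .seq (.set cntCell (.sub (.var cntCell) (.const 1))) (.assign (.var cntCell) (.const 0))

/-- Write the four coefficients of the generator to the output. -/
def writeOut : Prog :=
  -- The order matters for `n = 1`, where the quarter of the dimension is `0`: the odd coefficients
  -- then go to cells that the even ones overwrite.
  .seq (.assign (.div (.var dimCell) (.const 4)) (Expr8.var genCell).c1)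
    (.seq (.assign (.add (.div (.var dimCell) (.const 2)) (.div (.var dimCell) (.const 4)))
      (Expr8.var genCell).c3)
    (.seq (.assign (.const 0) (Expr8.var genCell).c0)
      (.assign (.div (.var dimCell) (.const 2)) (Expr8.var genCell).c2)))

/-- The program that computes a shortest vector. -/
def svpProg : Prog :=
  .seq dimInit (.seq (.loop (.var cntCell) dimBody) (.seq numInit (.seq (.loop gcdCond gcdBody)
    (.seq (.loop unitCond unitBody) (.seq clearInit (.seq (.loop (.var cntCell) clearBody)
      writeOut))))))

/-! ### Effect of the loop bodies on the memory -/

theorem get8_congr {μ μ' : Mem} {a : ℤ} (h : ∀ c, c ≤ a → a - 3 ≤ c → μ' c = μ c) :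
    μ'.get8 a = μ.get8 a := by
  simp only [Mem.get8]
  rw [h, h, h, h] <;> omega

/-- The input lies at nonnegative addresses and the work cells at negative ones, so the quadruples
keep their values while the algorithm runs. -/
theorem quad_nonneg_congr {f g : ℤ → ℤ} {n : ℕ} {i : ℕ} (h : ∀ c, 0 ≤ c → f c = g c) :
    quad f (2 ^ n) i = quad g (2 ^ n) i := by
  have h0 : (0 : ℤ) ≤ 2 ^ n / 4 + 2 / 2 ^ n := by positivity
  have h1 : (0 : ℤ) ≤ i - i / (2 ^ n / 4 + 2 / 2 ^ n) * (2 ^ n / 4 + 2 / 2 ^ n) :=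
    by
    rw [sub_nonneg]
    rcases h0.eq_or_lt with h0 | h0
    · simp [← h0]
    · exact Int.ediv_mul_le _ h0.ne'
  simp only [quad]
  rw [h, h, h, h] <;> positivity

theorem run_set8_var {μ : Mem} {a c : ℤ} (h : a < c - 3 ∨ c < a - 3) :
    (Prog.set8 a (.var c)).run μ = μ.set8 a (μ.get8 c) := by
  rw [Prog.run_set8, Expr8.eval_var]
  intro μ' h'
  rw [Expr8.eval_var, Expr8.eval_var]
  exact get8_congr fun d _ _ => h' d (by omega)

theorem sqLen_get8_pos_iff {μ : Mem} {a : ℤ} :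
    0 < (Expr8.var a).sqLen.eval μ ↔ μ.get8 a ≠ 0 := by
  rw [Expr8.eval_sqLen, Expr8.eval_var]
  refine ⟨fun h h' => ?_, Z8.sqLen_pos⟩
  rw [h', Z8.sqLen_eq_zero.2 rfl] at h
  exact h.false

theorem run_gcdBody_of_ne {μ : Mem} (h : μ.get8 divCell ≠ 0) : gcdBody.run μ =
    ((μ.set8 tmpCell ((μ.get8 genCell).rem (μ.get8 divCell))).set8 genCell
      (μ.get8 divCell)).set8 divCell ((μ.get8 genCell).rem (μ.get8 divCell)) := by
  rw [gcdBody, Prog.run, if_pos (sqLen_get8_pos_iff.2 h), Prog.run, Prog.run,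
    run_set8_var (by norm_num), run_set8_var (by norm_num), Prog.run_set8, Expr8.eval_rem,
    Expr8.eval_var,
    Expr8.eval_var, Mem.get8_set8_of_disjoint (by norm_num),
    Mem.get8_set8_of_disjoint (by norm_num), Mem.get8_set8_self]
  intro μ' h'
  simp only [Expr8.eval_rem, Expr8.eval_var]
  rw [get8_congr fun d _ _ => h' d (by omega), get8_congr fun d _ _ => h' d (by omega)]

theorem run_gcdBody_of_eq {μ : Mem} {n i : ℕ} (hn : μ dimCell = 2 ^ n) (hi : μ idxCell = i)
    (h : μ.get8 divCell = 0) : gcdBody.run μ =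
      Function.update (μ.set8 divCell (quad μ (2 ^ n) i)) idxCell (i + 1) := by
  rw [gcdBody, Prog.run, if_neg (by rwa [sqLen_get8_pos_iff, not_not]), Prog.run, Prog.run_set8,
    eval_quadE, hn, hi]
  · simp only [Prog.run, Expr.eval]
    rw [Mem.set8_of_notMem (by norm_num), hi]
  · intro μ' h'
    rw [eval_quadE, eval_quadE, h' _ (by norm_num), h' _ (by norm_num), hn, hi]
    exact quad_nonneg_congr fun c hc => h' c (by omega)

theorem run_unitBody (μ : Mem) : unitBody.run μ =
    (μ.set8 tmpCell (μ.get8 genCell).unitStep).set8 genCell (μ.get8 genCell).unitStep := by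
  have key : ∀ z, (Prog.set8 tmpCell ((Expr8.var genCell).mul (.ofZ8 z))).run μ =
      μ.set8 tmpCell (μ.get8 genCell * z) := by
    intro z
    rw [Prog.run_set8, Expr8.eval_mul, Expr8.eval_var, Expr8.eval_ofZ8]
    intro μ' h'
    rw [Expr8.eval_mul, Expr8.eval_mul, Expr8.eval_ofZ8, Expr8.eval_ofZ8, Expr8.eval_var,
      Expr8.eval_var, get8_congr fun d _ _ => h' d (by omega)]
  rw [unitBody, Prog.run, Prog.run, key, key, Expr8.eval_cross, Expr8.eval_var, Z8.unitStep]
  split_ifs <;> rw [run_set8_var (by norm_num), Mem.get8_set8_self]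

/-! ### Correctness and cost of the program -/

theorem Mem.bounded_of_abs_le {μ : Mem} {k : ℕ} (h : ∀ c, |μ c| ≤ 2 ^ k) : μ.Bounded (k + 2) := by
  intro c
  rw [bitLen_le_iff, ← Nat.cast_lt (α := ℤ), Int.natCast_natAbs]
  push_cast
  exact (h c).trans_lt (pow_lt_pow_right₀ (by norm_num) (by omega))

theorem Nat.size_lt_size_of_two_mul_le {a b : ℕ} (h : 2 * a ≤ b) (hb : 0 < b) :
    a.size < b.size := by
  rw [Nat.lt_size]
  rcases h0 : a.size with _ | k
  · simpa using Nat.one_le_iff_ne_zero.2 hb.ne'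
  · have := Nat.lt_size.1 (by omega : k < a.size)
    rw [pow_succ]
    omega

theorem exec_dim : ∃ K : ℕ, ∀ (f : Mem) (n e : ℕ), (∀ c, |f c| ≤ 2 ^ e) → f 0 = n → n ≤ e →
    (∀ c < 0, f c = 0) → ∃ ν t, Exec (.seq dimInit (.loop (.var cntCell) dimBody)) f ν t ∧
      t ≤ K * (e + 2) ^ 3 ∧ (∀ c, 0 ≤ c → ν c = f c) ∧ ν dimCell = 2 ^ n ∧ ν cntCell = 0 ∧
      ∀ c < -2, ν c = 0 := by
  obtain ⟨K₁, h₁⟩ := Prog.LoopFree.exists_cost_bound (P := dimInit) ⟨trivial, trivial⟩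
  obtain ⟨K₂, h₂⟩ := Exec.exists_loop_bound (.var cntCell) (P := dimBody) ⟨trivial, trivial⟩
  refine ⟨K₁ + K₂, fun f n e hf h0 hn hneg => ?_⟩
  obtain ⟨t₁, r₁, c₁⟩ := h₁ _ f (Mem.bounded_of_abs_le hf)
  have hrun : dimInit.run f = Function.update (Function.update f cntCell n) dimCell 1 := by
    simp [dimInit, Prog.run, Expr.eval, h0]
  have hne : (n : ℤ) ≤ 2 ^ e := by
    have : n < 2 ^ n := Nat.lt_two_pow_self
    have : 2 ^ n ≤ 2 ^ e := Nat.pow_le_pow_right (by norm_num) hn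
    exact_mod_cast (by omega : n ≤ 2 ^ e)
  obtain ⟨ν, t₂, r₂, c₂, ⟨i1, i2, j, hj, i3, i4⟩, hc⟩ := h₂ (e + 2)
    (fun μ => (∀ c, 0 ≤ c → μ c = f c) ∧ (∀ c < -2, μ c = 0) ∧
      ∃ j : ℕ, j ≤ n ∧ μ dimCell = 2 ^ j ∧ μ cntCell = n - j) (fun μ => (μ cntCell).toNat)
    (by
      rintro μ ⟨i1, i2, j, hj, i3, i4⟩
      refine Mem.bounded_of_abs_le fun c => ?_
      rcases le_or_gt 0 c with h | h
      · rw [i1 c h]; exact hf c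
      rcases lt_or_ge c (-2) with h' | h'
      · rw [i2 c h']; simp
      obtain rfl | rfl : c = -1 ∨ c = -2 := by omega
      · rw [i3, abs_of_pos (by positivity)]
        exact pow_le_pow_right₀ (by norm_num) (by omega)
      · rw [i4, abs_of_nonneg (by omega)]
        omega)
    (by
      rintro μ ⟨i1, i2, j, hj, i3, i4⟩ hc
      simp only [Expr.eval, i4] at hc
      have hr : dimBody.run μ = Function.update (Function.update μ dimCell (2 ^ (j + 1))) cntCell
          (n - (j + 1 : ℕ)) := by
        simp [dimBody, Prog.run, Expr.eval, i3, i4, pow_succ, mul_two, sub_sub]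
      rw [hr]
      refine ⟨⟨fun c hc => ?_, fun c hc => ?_, j + 1, by omega, by simp, by simp⟩, ?_⟩
      · rw [Function.update_of_ne (by omega), Function.update_of_ne (by omega), i1 c hc]
      · rw [Function.update_of_ne (by omega), Function.update_of_ne (by omega), i2 c hc]
      · simp only [Function.update_self, i4]
        omega) (dimInit.run f) (by
      rw [hrun]
      refine ⟨fun c hc => ?_, fun c hc => ?_, 0, by omega, by simp, by simp⟩
      · rw [Function.update_of_ne (by omega), Function.update_of_ne (by omega)]
      · rw [Function.update_of_ne (by omega), Function.update_of_ne (by omega)]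
        exact hneg c (by omega))
  refine ⟨ν, _, .seq r₁ r₂, ?_, i1, ?_, ?_, i2⟩
  · have h3 : (dimInit.run f cntCell).toNat + 1 ≤ e + 2 := by
      rw [hrun]; simp; omega
    have h4 : K₂ * ((dimInit.run f cntCell).toNat + 1) * (e + 2) ^ 2 ≤
      K₂ * (e + 2) * (e + 2) ^ 2 := by gcongr
    have h5 : K₁ * (e + 2) ^ 2 ≤ K₁ * (e + 2) ^ 3 := by gcongr <;> omega
    calc t₁ + t₂ ≤ K₁ * (e + 2) ^ 3 + K₂ * (e + 2) * (e + 2) ^ 2 := by omega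
      _ = _ := by ring
  · simp only [Expr.eval, i4] at hc
    rw [i3, show j = n by omega]
  · simp only [Expr.eval, i4] at hc
    omega

/-! ### Analysis of the Euclidean algorithm -/

theorem quarter_eq {n : ℕ} (hn : 0 < n) :
    (n = 1 ∧ (2 : ℤ) / 2 ^ n = 1) ∨ (2 ≤ n ∧ (2 : ℤ) / 2 ^ n = 0) := by
  rcases (by omega : n = 1 ∨ 2 ≤ n) with rfl | h
  · left; norm_num
  · right
    refine ⟨h, Int.ediv_eq_zero_of_lt (by norm_num) ?_⟩
    calc (2 : ℤ) < 2 ^ 2 := by norm_num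
      _ ≤ 2 ^ n := pow_le_pow_right₀ (by norm_num) h

theorem quad_le {f : ℤ → ℤ} {X : ℤ} (hf : ∀ c, |f c| ≤ X) {n : ℕ} (hn : 0 < n) (i : ℤ) :
    (quad f (2 ^ n) i).Le X := by
  have hX : 0 ≤ X := (abs_nonneg _).trans (hf 0)
  rcases quarter_eq hn with ⟨-, h⟩ | ⟨-, h⟩ <;> simp only [quad, h, Z8.Le] <;> simp [hf, hX]

theorem quad_even {f : ℤ → ℤ} {n : ℕ} (hn : n = 1) (i : ℤ) :
    (quad f (2 ^ n) i).c1 = 0 ∧ (quad f (2 ^ n) i).c3 = 0 := by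
  subst hn
  simp [quad]

/-- `nm ≤ sqLen ^ 2 ≤ (4 * 2 ^ (2 * L)) ^ 2 = 2 ^ (4 * L + 4)`, and the square of this is `2 ^ (8 *
L + 8)`. -/
theorem Z8.size_nm_sq_le {z : Z8} {L : ℕ} (h : z.Le (2 ^ L)) :
    Nat.size (z.nm ^ 2).toNat ≤ 8 * L + 9 := by
  rw [Nat.size_le]
  have h1 := h.sqLen_le
  have h2 := z.nm_le_sqLen_sq
  have h3 : z.nm ≤ (4 * (2 ^ L) ^ 2) ^ 2 := h2.trans (pow_le_pow_left₀ z.sqLen_nonneg h1 2)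
  have h4 := pow_le_pow_left₀ z.nm_nonneg h3 2
  have h5 : ((4 * ((2 : ℤ) ^ L) ^ 2) ^ 2) ^ 2 < 2 ^ (8 * L + 9) := by
    rw [show ((4 * ((2 : ℤ) ^ L) ^ 2) ^ 2) ^ 2 = 2 ^ (8 * L + 8) by ring]
    exact pow_lt_pow_right₀ (by norm_num) (by omega)
  have h6 : ((z.nm ^ 2).toNat : ℤ) < 2 ^ (8 * L + 9) := by
    rw [Int.toNat_of_nonneg (by positivity)]
    linarith
  exact_mod_cast h6

/-- The factor `11/16` alone need not cost a binary digit, but `(11/16) ^ 2 < 1/2` does. Hence the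
potential uses the square of the norm. -/
theorem Z8.size_nm_rem_lt (a : Z8) {b : Z8} (hb : b ≠ 0) :
    Nat.size ((Z8.rem a b).nm ^ 2).toNat < Nat.size (b.nm ^ 2).toNat := by
  have h := nm_rem_le a hb
  have h0 := (Z8.rem a b).nm_nonneg
  have h1 := nm_pos hb
  have h2 := pow_pos h1 2
  apply Nat.size_lt_size_of_two_mul_le
  · have : 2 * (Z8.rem a b).nm ^ 2 ≤ b.nm ^ 2 := by nlinarith
    omega
  · omega

theorem Z8.span_rem (a b : Z8) (S : Set Z8) :
    Ideal.span ({b, Z8.rem a b} ∪ S) = Ideal.span ({a, b} ∪ S) := by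
  have h1 : b ∈ Ideal.span ({b, Z8.rem a b} ∪ S) := Ideal.subset_span (by simp)
  have h2 : Z8.rem a b ∈ Ideal.span ({b, Z8.rem a b} ∪ S) := Ideal.subset_span (by simp)
  have h3 : a ∈ Ideal.span ({a, b} ∪ S) := Ideal.subset_span (by simp)
  have h4 : b ∈ Ideal.span ({a, b} ∪ S) := Ideal.subset_span (by simp)
  apply le_antisymm <;> rw [Ideal.span_le]
  · rintro z ((rfl | rfl) | hz)
    · exact h4
    · exact sub_mem h3 (Ideal.mul_mem_left _ _ h4)
    · exact Ideal.subset_span (Or.inr hz)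
  · rintro z ((rfl | rfl) | hz)
    · have := add_mem h2 (Ideal.mul_mem_left _ (Z8.quo z b) h1)
      rwa [Z8.rem, sub_add_cancel] at this
    · exact h1
    · exact Ideal.subset_span (Or.inr hz)

theorem Z8.span_insert_zero (a : Z8) (S : Set Z8) :
    Ideal.span ({a, 0} ∪ S) = Ideal.span ({a} ∪ S) := by
  rw [Set.pair_comm, Set.insert_union, Ideal.span_insert_zero]

/-- Bounds the number of remaining steps of the Euclidean algorithm. -/
def gcdPotential (L M : ℕ) (μ : Mem) : ℕ :=
  -- Each unread quadruple contributes one unit for its reading and `8 * L + 9` for the divisions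
  -- that follow, as in `Z8.size_nm_sq_le`.
  (M - μ idxCell).toNat * (8 * L + 10) + Nat.size ((μ.get8 divCell).nm ^ 2).toNat

/-- The invariant of the Euclidean algorithm. -/
structure GcdInv (f : Mem) (n L M : ℕ) (μ : Mem) : Prop where
  input : ∀ c, 0 ≤ c → μ c = f c
  dim : μ dimCell = 2 ^ n
  num : μ numCell = M
  -- The two operands together with the unread quadruples always generate the same ideal.
  idx : ∃ i : ℕ, i ≤ M ∧ μ idxCell = i ∧
    Ideal.span ({μ.get8 genCell, μ.get8 divCell} ∪ (fun j : ℕ => quad f (2 ^ n) j) '' Set.Ico i M) =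
      Ideal.span ((fun j : ℕ => quad f (2 ^ n) j) '' Set.Iio M)
  pot : gcdPotential L M μ ≤ M * (8 * L + 10)
  -- A division may double the cells but lowers the potential by at least one, so the exponent pays
  -- for the doubling.
  small : ∀ c < 0, |μ c| ≤ 2 ^ (L + M * (8 * L + 10) - gcdPotential L M μ)
  even : n = 1 → ((μ.get8 genCell).c1 = 0 ∧ (μ.get8 genCell).c3 = 0) ∧
    ((μ.get8 divCell).c1 = 0 ∧ (μ.get8 divCell).c3 = 0)

theorem GcdInv.abs_le {f : Mem} {n L M : ℕ} {μ : Mem} (h : GcdInv f n L M μ)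
    (hf : ∀ c, |f c| ≤ 2 ^ L) (c : ℤ) : |μ c| ≤ 2 ^ (L + M * (8 * L + 10)) := by
  rcases le_or_gt 0 c with hc | hc
  · rw [h.input c hc]
    exact (hf c).trans (pow_le_pow_right₀ (by norm_num) (by omega))
  · exact (h.small c hc).trans (pow_le_pow_right₀ (by norm_num) (by omega))

theorem GcdInv.step_rem {f : Mem} {n L M : ℕ} {μ : Mem} (h : GcdInv f n L M μ)
    (hB : μ.get8 divCell ≠ 0) : GcdInv f n L M (gcdBody.run μ) ∧
      gcdPotential L M (gcdBody.run μ) < gcdPotential L M μ := by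
  obtain ⟨i, hi, hidx, hspan⟩ := h.idx
  rw [run_gcdBody_of_ne hB]
  set A := μ.get8 genCell with hA
  set B := μ.get8 divCell with hB'
  set ν := ((μ.set8 tmpCell (A.rem B)).set8 genCell B).set8 divCell (A.rem B) with hν
  have hframe : ∀ c, genCell < c → ν c = μ c := fun c hc => by
    rw [hν, Mem.set8_of_notMem (by omega), Mem.set8_of_notMem (by omega),
      Mem.set8_of_notMem (by omega)]
  have hgen : ν.get8 genCell = B := by
    rw [hν, Mem.get8_set8_of_disjoint (by norm_num), Mem.get8_set8_self]
  have hdiv : ν.get8 divCell = A.rem B := by rw [hν, Mem.get8_set8_self]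
  have hpot : gcdPotential L M ν < gcdPotential L M μ := by
    rw [gcdPotential, gcdPotential, hframe _ (by norm_num), hdiv]
    exact Nat.add_lt_add_left (Z8.size_nm_rem_lt A hB) _
  have hp := h.pot
  have hle : B.Le (2 ^ (L + M * (8 * L + 10) - gcdPotential L M μ)) :=
    ⟨h.small _ (by norm_num), h.small _ (by norm_num), h.small _ (by norm_num),
      h.small _ (by norm_num)⟩
  have hexp : (2 : ℤ) * 2 ^ (L + M * (8 * L + 10) - gcdPotential L M μ) ≤
      2 ^ (L + M * (8 * L + 10) - gcdPotential L M ν) := by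
    rw [← pow_succ']
    exact pow_le_pow_right₀ (by norm_num) (by omega)
  have hexp' : (2 : ℤ) ^ (L + M * (8 * L + 10) - gcdPotential L M μ) ≤
      2 ^ (L + M * (8 * L + 10) - gcdPotential L M ν) :=
    pow_le_pow_right₀ (by norm_num) (by omega)
  have hrem : (A.rem B).Le (2 ^ (L + M * (8 * L + 10) - gcdPotential L M ν)) := by
    obtain ⟨h0, h1, h2, h3⟩ := hle.rem hB A
    exact ⟨h0.trans hexp, h1.trans hexp, h2.trans hexp, h3.trans hexp⟩
  have hle' : B.Le (2 ^ (L + M * (8 * L + 10) - gcdPotential L M ν)) := by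
    obtain ⟨h0, h1, h2, h3⟩ := hle
    exact ⟨h0.trans hexp', h1.trans hexp', h2.trans hexp', h3.trans hexp'⟩
  refine ⟨⟨fun c hc => ?_, ?_, ?_, ⟨i, hi, ?_, ?_⟩, by omega, fun c hc => ?_, fun hn => ?_⟩, hpot⟩
  · rw [hframe c (by omega), h.input c hc]
  · rw [hframe _ (by norm_num), h.dim]
  · rw [hframe _ (by norm_num), h.num]
  · rw [hframe _ (by norm_num), hidx]
  · rw [hgen, hdiv, Z8.span_rem, hspan]
  · exact Mem.abs_set8_le hrem (Mem.abs_set8_le hle' (Mem.abs_set8_le hrem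
      ((h.small c hc).trans hexp')))
  · obtain ⟨⟨h1, h3⟩, h1', h3'⟩ := h.even hn
    rw [hgen, hdiv]
    exact ⟨⟨h1', h3'⟩, Z8.rem_even hB h1 h3 h1' h3'⟩

theorem GcdInv.step_read {f : Mem} {n L M : ℕ} (hn : 0 < n) {μ : Mem} (h : GcdInv f n L M μ)
    (hf : ∀ c, |f c| ≤ 2 ^ L) (hM : M ≤ 2 ^ L) (hB : μ.get8 divCell = 0)
    (hlt : μ idxCell < M) : GcdInv f n L M (gcdBody.run μ) ∧
      gcdPotential L M (gcdBody.run μ) < gcdPotential L M μ := by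
  obtain ⟨i, hi, hidx, hspan⟩ := h.idx
  rw [run_gcdBody_of_eq h.dim hidx hB, quad_nonneg_congr h.input]
  have hg := quad_le hf hn i
  set g := quad f (2 ^ n) i with hgdef
  set ν : Mem := Function.update (μ.set8 divCell g) idxCell (i + 1) with hν
  have hiM : i < M := by rw [hidx] at hlt; exact_mod_cast hlt
  have hframe : ∀ c, idxCell < c → ν c = μ c := fun c hc => by
    rw [hν, Function.update_of_ne (by omega), Mem.set8_of_notMem (by omega)]
  have hνidx : ν idxCell = (i + 1 : ℕ) := by rw [hν, Function.update_self]; simp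
  have hgen : ν.get8 genCell = μ.get8 genCell := get8_congr fun c h1 h2 => by
    rw [hν, Function.update_of_ne (by omega), Mem.set8_of_notMem (by omega)]
  have hdiv : ν.get8 divCell = g := by
    rw [hν, ← Mem.get8_set8_self μ divCell g]
    exact get8_congr fun c h1 h2 => Function.update_of_ne (by omega) _ _
  have hsz := Z8.size_nm_sq_le hg
  have hpot : gcdPotential L M ν < gcdPotential L M μ := by
    rw [gcdPotential, gcdPotential, hνidx, hdiv, hidx]
    rw [show ((M : ℤ) - i).toNat = ((M : ℤ) - (i + 1 : ℕ)).toNat + 1 by omega, add_mul]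
    omega
  have hp := h.pot
  have hexp' : (2 : ℤ) ^ (L + M * (8 * L + 10) - gcdPotential L M μ) ≤
      2 ^ (L + M * (8 * L + 10) - gcdPotential L M ν) :=
    pow_le_pow_right₀ (by norm_num) (by omega)
  have hexpL : (2 : ℤ) ^ L ≤ 2 ^ (L + M * (8 * L + 10) - gcdPotential L M ν) :=
    pow_le_pow_right₀ (by norm_num) (by omega)
  have hg' : g.Le (2 ^ (L + M * (8 * L + 10) - gcdPotential L M ν)) := by
    obtain ⟨h0, h1, h2, h3⟩ := hg
    exact ⟨h0.trans hexpL, h1.trans hexpL, h2.trans hexpL, h3.trans hexpL⟩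
  refine ⟨⟨fun c hc => ?_, ?_, ?_, ⟨i + 1, hiM, hνidx, ?_⟩, by omega, fun c hc => ?_, fun hn => ?_⟩,
    hpot⟩
  · rw [hframe c (by omega), h.input c hc]
  · rw [hframe _ (by norm_num), h.dim]
  · rw [hframe _ (by norm_num), h.num]
  · rw [← hspan, hgen, hdiv, hB, Z8.span_insert_zero,
      show Set.Ico i M = insert i (Set.Ico (i + 1) M) by ext; simp; omega, Set.image_insert_eq,
      Set.singleton_union, Set.insert_union, Set.singleton_union]
  · by_cases hc' : c = idxCell
    · rw [hc', hνidx, abs_of_nonneg (by positivity)]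
      refine le_trans ?_ hexpL
      exact_mod_cast (by omega : i + 1 ≤ 2 ^ L)
    · rw [hν, Function.update_of_ne hc']
      exact Mem.abs_set8_le hg' ((h.small c hc).trans hexp')
  · obtain ⟨⟨h1, h3⟩, -⟩ := h.even hn
    rw [hgen, hdiv]
    exact ⟨⟨h1, h3⟩, quad_even hn i⟩

theorem exec_gcd : ∃ K : ℕ, ∀ (f : Mem) (n L M : ℕ), 0 < n → (∀ c, |f c| ≤ 2 ^ L) → M ≤ 2 ^ L →
    n ≤ L → ∀ μ : Mem, (∀ c, 0 ≤ c → μ c = f c) → μ dimCell = 2 ^ n → μ cntCell = 0 →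
    μ numCell = M → (∀ c < -3, μ c = 0) → ∃ ν t, Exec (.loop gcdCond gcdBody) μ ν t ∧
      t ≤ K * (M * (8 * L + 10) + 1) * (L + M * (8 * L + 10) + 2) ^ 2 ∧
      (∀ c, |ν c| ≤ 2 ^ (L + M * (8 * L + 10))) ∧ ν dimCell = 2 ^ n ∧
      Ideal.span {ν.get8 genCell} = Ideal.span ((fun j : ℕ => quad f (2 ^ n) j) '' Set.Iio M) ∧
      (n = 1 → (ν.get8 genCell).c1 = 0 ∧ (ν.get8 genCell).c3 = 0) := by
  obtain ⟨K, hK⟩ := Exec.exists_loop_bound gcdCond (P := gcdBody)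
    ⟨⟨Prog.set8_loopFree _ _, Prog.set8_loopFree _ _, Prog.set8_loopFree _ _⟩,
      Prog.set8_loopFree _ _, trivial⟩
  refine ⟨K, fun f n L M hn hf hM hnL μ h1 h2 h3 h4 h5 => ?_⟩
  have hcond : ∀ μ, gcdCond.eval μ = μ numCell - μ idxCell + (μ.get8 divCell).sqLen := fun μ => by
    rw [gcdCond, Expr.eval, Expr8.eval_sqLen, Expr8.eval_var]; rfl
  have hgen0 : μ.get8 genCell = 0 := by
    simp only [Mem.get8]
    rw [h5, h5, h5, h5] <;> first | rfl | norm_num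
  have hdiv0 : μ.get8 divCell = 0 := by
    simp only [Mem.get8]
    rw [h5, h5, h5, h5] <;> first | rfl | norm_num
  have hidx0 : μ idxCell = 0 := h5 _ (by norm_num)
  have hpot0 : gcdPotential L M μ = M * (8 * L + 10) := by
    simp [gcdPotential, hidx0, hdiv0, Z8.nm_eq_zero.2 rfl]
  have hinit : GcdInv f n L M μ := by
    refine ⟨h1, h2, h4, ⟨0, by omega, by simpa using hidx0, ?_⟩, hpot0.le, fun c hc => ?_,
      fun _ => by simp [hgen0, hdiv0]⟩
    · rw [hgen0, hdiv0, Z8.span_insert_zero, Set.singleton_union, Ideal.span_insert_zero]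
      congr 2
      ext; simp
    · rw [hpot0, Nat.add_sub_cancel]
      rcases lt_or_ge c (-3) with h | h
      · rw [h5 c h]; simp
      obtain rfl | rfl | rfl : c = -1 ∨ c = -2 ∨ c = -3 := by omega
      · rw [h2, abs_of_pos (by positivity)]
        exact pow_le_pow_right₀ (by norm_num) hnL
      · rw [h3]; simp
      · rw [h4, abs_of_nonneg (by positivity)]; exact_mod_cast hM
  obtain ⟨ν, t, hr, ht, hν, hc⟩ := hK _ (GcdInv f n L M) (gcdPotential L M)
    (fun μ h => Mem.bounded_of_abs_le (h.abs_le hf)) (fun μ h hc => by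
      by_cases hB : μ.get8 divCell = 0
      · refine h.step_read hn hf hM hB ?_
        rw [hcond, hB, Z8.sqLen_eq_zero.2 rfl, h.num] at hc
        linarith
      · exact h.step_rem hB) μ hinit
  rw [hpot0] at ht
  obtain ⟨i, hi, hidx, hspan⟩ := hν.idx
  rw [hcond, hν.num, hidx] at hc
  have hs := (ν.get8 divCell).sqLen_nonneg
  have hi' : i = M := by omega
  have hB : ν.get8 divCell = 0 := Z8.sqLen_eq_zero.1 (by omega)
  refine ⟨ν, t, hr, ht, hν.abs_le hf, hν.dim, ?_, fun h => (hν.even h).1⟩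
  rw [← hspan, hB, Z8.span_insert_zero, hi']
  simp

/-! ### Analysis of the unit reduction and of the output -/

theorem Z8.span_unitStep (z : Z8) : Ideal.span {z.unitStep} = Ideal.span {z} := by
  obtain ⟨u, v, h, huv⟩ := z.unitStep_isUnit
  rw [h]
  exact Ideal.span_singleton_mul_right_unit (IsUnit.of_mul_eq_one v huv) z

theorem exec_unit : ∃ K : ℕ, ∀ (e : ℕ) (μ : Mem), (∀ c, |μ c| ≤ 2 ^ e) →
    (μ.get8 genCell).sqLen ≤ 2 ^ e → ∃ ν t, Exec (.loop unitCond unitBody) μ ν t ∧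
      t ≤ K * (e + 2) ^ 3 ∧ (∀ c, |ν c| ≤ 2 ^ e) ∧ ν dimCell = μ dimCell ∧
      Ideal.span {ν.get8 genCell} = Ideal.span {μ.get8 genCell} ∧
      4 * (ν.get8 genCell).cross ^ 2 ≤ (ν.get8 genCell).sqLen ^ 2 ∧
      ((μ.get8 genCell).c1 = 0 ∧ (μ.get8 genCell).c3 = 0 →
        (ν.get8 genCell).c1 = 0 ∧ (ν.get8 genCell).c3 = 0) := by
  obtain ⟨K, hK⟩ := Exec.exists_loop_bound unitCond (P := unitBody)
    ⟨⟨Prog.set8_loopFree _ _, Prog.set8_loopFree _ _⟩, Prog.set8_loopFree _ _⟩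
  refine ⟨K, fun e μ hμ hlen => ?_⟩
  have hcond : ∀ ν : Mem, unitCond.eval ν =
      4 * (ν.get8 genCell).cross * (ν.get8 genCell).cross -
        (ν.get8 genCell).sqLen * (ν.get8 genCell).sqLen := fun ν => by
    simp only [unitCond, Expr.eval, Expr8.eval_sqLen, Expr8.eval_cross, Expr8.eval_var]
  -- The potential is set to `0` on reduced elements, because the last step need not shrink the
  -- length by a factor.
  set Ψ : Mem → ℕ := fun ν => if 0 < unitCond.eval ν then
    Nat.size (ν.get8 genCell).sqLen.toNat else 0 with hΨ
  obtain ⟨ν, t, hr, ht, ⟨i1, i2, i3, i4, i5⟩, hc⟩ := hK (e + 2)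
    (fun ν => (∀ c, |ν c| ≤ 2 ^ e) ∧ (∀ c, tmpCell < c - 3 ∧ genCell < c → ν c = μ c) ∧
      (ν.get8 genCell).sqLen ≤ 2 ^ e ∧
      Ideal.span {ν.get8 genCell} = Ideal.span {μ.get8 genCell} ∧
      ((μ.get8 genCell).c1 = 0 ∧ (μ.get8 genCell).c3 = 0 →
        (ν.get8 genCell).c1 = 0 ∧ (ν.get8 genCell).c3 = 0)) Ψ
    (fun ν h => Mem.bounded_of_abs_le h.1)
    (by
      rintro ν ⟨i1, i2, i3, i4, i5⟩ hc
      have hc' := hc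
      rw [hcond] at hc'
      rw [run_unitBody]
      set A := ν.get8 genCell with hA
      set ρ : Mem := (ν.set8 tmpCell A.unitStep).set8 genCell A.unitStep with hρ
      have hgen : ρ.get8 genCell = A.unitStep := by rw [hρ, Mem.get8_set8_self]
      obtain ⟨h1, h2⟩ := Z8.unitStep_reduced_or hc'
      have hle : A.unitStep.Le (2 ^ e) := by
        obtain ⟨g0, g1, g2, g3⟩ := A.unitStep.le_sqLen
        have := h1.trans i3
        exact ⟨g0.trans this, g1.trans this, g2.trans this, g3.trans this⟩
      refine ⟨⟨fun c => Mem.abs_set8_le hle (Mem.abs_set8_le hle (i1 c)), fun c hc => ?_, ?_, ?_,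
        fun h => ?_⟩, ?_⟩
      · rw [hρ, Mem.set8_of_notMem (by omega), Mem.set8_of_notMem (by omega), i2 c hc]
      · rw [hgen]; exact h1.trans i3
      · rw [hgen, Z8.span_unitStep, i4]
      · exact (Z8.not_shortened_of_even hc' (i5 h).1 (i5 h).2).elim
      · have hpos : 0 < A.sqLen := by
          refine lt_of_le_of_ne A.sqLen_nonneg fun h => ?_
          rw [Z8.sqLen_eq_zero.1 h.symm] at hc'
          simp [Z8.sqLen, Z8.cross] at hc'
        have h0 := A.unitStep.sqLen_nonneg
        simp only [hΨ, if_pos hc]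
        rw [← hA, hcond, hgen]
        split_ifs with h3
        · apply Nat.size_lt_size_of_two_mul_le
          · have := h2.resolve_left (not_not.2 h3)
            omega
          · omega
        · rw [Nat.lt_size]
          simp
          omega)
    μ ⟨hμ, fun _ _ => rfl, hlen, rfl, id⟩
  refine ⟨ν, t, hr, ht.trans ?_, i1, i2 _ (by norm_num), i4, ?_, i5⟩
  · have : Ψ μ + 1 ≤ e + 2 := by
      have h1 : Nat.size (μ.get8 genCell).sqLen.toNat ≤ e + 1 := by
        rw [Nat.size_le, pow_succ]
        have : (μ.get8 genCell).sqLen.toNat ≤ 2 ^ e := by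
          rw [Int.toNat_le]; exact_mod_cast hlen
        have := Nat.pow_pos (n := e) (show 0 < 2 by norm_num)
        omega
      simp only [hΨ]
      split_ifs <;> omega
    calc K * (Ψ μ + 1) * (e + 2) ^ 2 ≤ K * (e + 2) * (e + 2) ^ 2 := by gcongr
      _ = _ := by ring
  · rw [hcond] at hc
    nlinarith

/-- The coefficient with number `i` of the output for the generator `z`. -/
def outCoeff (n : ℕ) (z : Z8) (i : ℕ) : ℤ :=
  if i = 2 ^ n / 2 then z.c2 else if i = 0 then z.c0 else
    if i = 2 ^ n / 2 + 2 ^ n / 4 then z.c3 else if i = 2 ^ n / 4 then z.c1 else 0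

/-- The output occupies the cells of the input, so these are cleared first. The loop has `2 ^ n`
rounds, which is polynomial because `2 ^ n ≤ e`. -/
theorem exec_output : ∃ K : ℕ, ∀ (e n : ℕ) (μ : Mem), (∀ c, |μ c| ≤ 2 ^ e) → 2 ^ n ≤ e →
    μ dimCell = 2 ^ n → ∃ ν t, Exec (.seq clearInit (.seq (.loop (.var cntCell) clearBody)
      writeOut)) μ ν t ∧ t ≤ K * (e + 2) ^ 3 ∧
      ∀ i : ℕ, i < 2 ^ n → ν i = outCoeff n (μ.get8 genCell) i := by
  obtain ⟨K₁, h₁⟩ := Prog.LoopFree.exists_cost_bound (P := clearInit) trivial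
  obtain ⟨K₂, h₂⟩ := Exec.exists_loop_bound (.var cntCell) (P := clearBody) ⟨trivial, trivial⟩
  obtain ⟨K₃, h₃⟩ := Prog.LoopFree.exists_cost_bound (P := writeOut)
    ⟨trivial, trivial, trivial, trivial⟩
  refine ⟨K₁ + K₂ + K₃, fun e n μ hμ hn hdim => ?_⟩
  obtain ⟨t₁, r₁, c₁⟩ := h₁ _ μ (Mem.bounded_of_abs_le hμ)
  have hrun : clearInit.run μ = Function.update μ cntCell (2 ^ n) := by
    simp [clearInit, Prog.run, Expr.eval, hdim]
  have hcnt : (2 : ℤ) ^ n ≤ 2 ^ e := pow_le_pow_right₀ (by norm_num)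
    ((Nat.lt_two_pow_self).le.trans hn)
  obtain ⟨ρ, t₂, r₂, c₂, ⟨i1, i2, k, hk, i3, i4⟩, hc⟩ := h₂ (e + 2)
    (fun ν => (∀ c, |ν c| ≤ 2 ^ e) ∧ (∀ c < 0, c ≠ cntCell → ν c = μ c) ∧
      ∃ k : ℕ, k ≤ 2 ^ n ∧ ν cntCell = k ∧ ∀ i : ℕ, k ≤ i → i < 2 ^ n → ν i = 0)
    (fun ν => (ν cntCell).toNat) (fun ν h => Mem.bounded_of_abs_le h.1)
    (by
      rintro ν ⟨i1, i2, k, hk, i3, i4⟩ hc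
      simp only [Expr.eval, i3] at hc
      obtain ⟨k, rfl⟩ := Nat.exists_eq_succ_of_ne_zero (n := k) (by omega)
      have hr : clearBody.run ν = Function.update (Function.update ν cntCell k) k 0 := by
        simp [clearBody, Prog.run, Expr.eval, i3]
      have hk' : (k : ℤ) ≤ 2 ^ e := le_trans (by exact_mod_cast (by omega : k ≤ 2 ^ n)) hcnt
      rw [hr]
      refine ⟨⟨fun c => ?_, fun c hc hc' => ?_, k, by omega, ?_, fun i hi hi' => ?_⟩, ?_⟩
      · simp only [Function.update_apply]
        split_ifs
        · simp
        · rwa [abs_of_nonneg (by positivity)]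
        · exact i1 c
      · rw [Function.update_of_ne (by omega), Function.update_of_ne hc', i2 c hc hc']
      · rw [Function.update_of_ne (by omega), Function.update_self]
      · rcases eq_or_ne i k with rfl | h
        · rw [Function.update_self]
        · rw [Function.update_of_ne (by omega), Function.update_of_ne (by omega),
            i4 i (by omega) hi']
      · rw [Function.update_of_ne (by omega), Function.update_self, i3]
        omega) (clearInit.run μ) (by
      rw [hrun]
      refine ⟨fun c => ?_, fun c hc hc' => Function.update_of_ne hc' _ _, 2 ^ n, le_rfl, by simp,
        fun i hi hi' => by omega⟩
      rw [Function.update_apply]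
      split_ifs
      · rwa [abs_of_nonneg (by positivity)]
      · exact hμ c)
  obtain ⟨t₃, r₃, c₃⟩ := h₃ _ ρ (Mem.bounded_of_abs_le i1)
  refine ⟨_, _, .seq r₁ (.seq r₂ r₃), ?_, fun i hi => ?_⟩
  · have h3 : (clearInit.run μ cntCell).toNat + 1 ≤ e + 2 := by
      rw [hrun, Function.update_self]
      have : ((2 : ℤ) ^ n).toNat = 2 ^ n := by
        rw [← Nat.cast_ofNat, ← Nat.cast_pow, Int.toNat_natCast]
      omega
    have h4 : K₂ * ((clearInit.run μ cntCell).toNat + 1) * (e + 2) ^ 2 ≤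
      K₂ * (e + 2) * (e + 2) ^ 2 := by gcongr
    have h5 : K₁ * (e + 2) ^ 2 ≤ K₁ * (e + 2) ^ 3 := by gcongr <;> omega
    have h6 : K₃ * (e + 2) ^ 2 ≤ K₃ * (e + 2) ^ 3 := by gcongr <;> omega
    calc t₁ + (t₂ + t₃) ≤ K₁ * (e + 2) ^ 3 + (K₂ * (e + 2) * (e + 2) ^ 2 + K₃ * (e + 2) ^ 3) := by
          omega
      _ = _ := by ring
  · simp only [Expr.eval, i3] at hc
    have hz : ρ i = 0 := i4 i (by omega) hi
    have hd : ρ dimCell = (2 ^ n : ℕ) := by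
      rw [i2 _ (by norm_num) (by norm_num), hdim]; simp
    have hg : ρ.get8 genCell = μ.get8 genCell := get8_congr fun c hc hc' =>
      i2 c (by omega) (by omega)
    have h2 : ((2 ^ n : ℕ) : ℤ) / 2 = (2 ^ n / 2 : ℕ) := by simp
    have h4 : ((2 ^ n : ℕ) : ℤ) / 4 = (2 ^ n / 4 : ℕ) := by simp
    have hnn : ∀ (σ : Mem) (k : ℕ) (x c : ℤ), c < 0 → Function.update σ k x c = σ c :=
      fun σ k x c hc => Function.update_of_ne (by omega) _ _
    have hnn' : ∀ (σ : Mem) (x c : ℤ), c < 0 → Function.update σ 0 x c = σ c :=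
      fun σ x c hc => Function.update_of_ne (by omega) _ _
    have hr : writeOut.run ρ = Function.update (Function.update (Function.update
        (Function.update ρ (2 ^ n / 4 : ℕ) (ρ.get8 genCell).c1)
        (2 ^ n / 2 + 2 ^ n / 4 : ℕ) (ρ.get8 genCell).c3) 0 (ρ.get8 genCell).c0)
        (2 ^ n / 2 : ℕ) (ρ.get8 genCell).c2 := by
      simp (discharger := norm_num) only [writeOut, Prog.run, Expr.eval, Expr8.var, hd, h2, h4,
        ← Nat.cast_add, hnn, hnn', Mem.get8]
    rw [hr, hg, outCoeff]
    simp only [Function.update_apply, Nat.cast_inj, hz, Nat.cast_eq_zero]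

/-- What the program computes, and its cost, in terms of the total length `L` of the input. -/
theorem exec_svpProg : ∃ K : ℕ, ∀ (f : Mem) (n m L : ℕ), 0 < n → (∀ c, |f c| ≤ 2 ^ L) →
    f 0 = n → f 1 = m → (∀ c < 0, f c = 0) → m * 2 ^ n ≤ L → 0 < m → ∀ M : ℕ,
    (M : ℤ) = m * (2 ^ n / 4 + 2 / 2 ^ n) → ∃ (ν : Mem) (t : ℕ) (z : Z8),
      Exec svpProg f ν t ∧ t ≤ K * L ^ 6 ∧
      Ideal.span {z} = Ideal.span ((fun j : ℕ => quad f (2 ^ n) j) '' Set.Iio M) ∧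
      4 * z.cross ^ 2 ≤ z.sqLen ^ 2 ∧ (n = 1 → z.c1 = 0 ∧ z.c3 = 0) ∧
      ∀ i : ℕ, i < 2 ^ n → ν i = outCoeff n z i := by
  obtain ⟨K₁, h₁⟩ := exec_dim
  obtain ⟨K₂, h₂⟩ := Prog.LoopFree.exists_cost_bound (P := numInit) trivial
  obtain ⟨K₃, h₃⟩ := exec_gcd
  obtain ⟨K₄, h₄⟩ := exec_unit
  obtain ⟨K₅, h₅⟩ := exec_output
  refine ⟨(K₁ + K₂ + K₃ + K₄ + K₅) * 42 ^ 3, fun f n m L hn hf hf0 hf1 hneg hmL hm M hM => ?_⟩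
  have hNL : 2 ^ n ≤ L := (Nat.le_mul_of_pos_left _ hm).trans hmL
  have hN1 : 2 ≤ 2 ^ n := by
    calc 2 = 2 ^ 1 := rfl
      _ ≤ 2 ^ n := Nat.pow_le_pow_right (by norm_num) hn
  have hnL : n ≤ L := (Nat.lt_two_pow_self).le.trans hNL
  have hML : M ≤ L := by
    have : (2 : ℤ) ^ n / 4 + 2 / 2 ^ n ≤ 2 ^ n := by
      rcases quarter_eq hn with ⟨rfl, h⟩ | ⟨-, h⟩
      · norm_num
      · rw [h]; have := Int.ediv_le_self (a := 2 ^ n) 4 (by positivity); omega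
    have h2 : (M : ℤ) ≤ m * 2 ^ n := by rw [hM]; gcongr
    have h3 : M ≤ m * 2 ^ n := by exact_mod_cast h2
    omega
  have hL2 : L < 2 ^ L := Nat.lt_two_pow_self
  set E := L + M * (8 * L + 10) with hE
  -- Cells of size `2 ^ E` give a squared length of at most `4 * (2 ^ E) ^ 2 = 2 ^ e`.
  set e := 2 * E + 2 with he
  have hLe : (2 : ℤ) ^ L ≤ 2 ^ e := pow_le_pow_right₀ (by norm_num) (by omega)
  obtain ⟨μ₁, t₁, r₁, c₁, a1, a2, a3, a4⟩ := h₁ f n e (fun c => (hf c).trans hLe) hf0 (by omega)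
    hneg
  have hμ₁ : ∀ c, |μ₁ c| ≤ 2 ^ e := by
    intro c
    rcases le_or_gt 0 c with h | h
    · rw [a1 c h]; exact (hf c).trans hLe
    rcases lt_or_ge c (-2) with h' | h'
    · rw [a4 c h']; simp
    obtain rfl | rfl : c = -1 ∨ c = -2 := by omega
    · rw [a2, abs_of_pos (by positivity)]
      exact pow_le_pow_right₀ (by norm_num) (by omega)
    · rw [a3]; simp
  obtain ⟨t₂, r₂, c₂⟩ := h₂ _ μ₁ (Mem.bounded_of_abs_le hμ₁)
  have hrun : numInit.run μ₁ = Function.update μ₁ numCell M := by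
    simp [numInit, Prog.run, Expr.eval, quarterE, a2, a1 1 (by norm_num), hf1, hM]
  rw [hrun] at r₂
  obtain ⟨μ₃, t₃, r₃, c₃, d1, d3, d4, d5⟩ := h₃ f n L M hn hf (by omega) hnL
    (Function.update μ₁ numCell M)
    (fun c hc => by rw [Function.update_of_ne (by omega), a1 c hc])
    (by rw [Function.update_of_ne (by omega), a2]) (by rw [Function.update_of_ne (by omega), a3])
    (by rw [Function.update_self])
    (fun c hc => by rw [Function.update_of_ne (by omega), a4 c (by omega)])
  have hEe : (2 : ℤ) ^ E ≤ 2 ^ e := pow_le_pow_right₀ (by norm_num) (by omega)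
  have hsq : (μ₃.get8 genCell).sqLen ≤ 2 ^ e := by
    have : (μ₃.get8 genCell).Le (2 ^ E) := ⟨d1 _, d1 _, d1 _, d1 _⟩
    refine this.sqLen_le.trans (le_of_eq ?_)
    rw [he]; ring
  obtain ⟨μ₄, t₄, r₄, c₄, e1, e3, e5, e6, e7⟩ := h₄ e μ₃ (fun c => (d1 c).trans hEe) hsq
  obtain ⟨ν, t₅, r₅, c₅, g1⟩ := h₅ e n μ₄ e1 (by omega) (by rw [e3, d3])
  cases r₁ with
  | seq r₁ r₁' =>
  refine ⟨ν, _, μ₄.get8 genCell, .seq r₁ (.seq r₁' (.seq r₂ (.seq r₃ (.seq r₄ r₅)))), ?_,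
    e5.trans d4, e6, fun h => e7 (d5 h), g1⟩
  rw [← hE] at c₃
  have hL2 : 2 * L ≤ L ^ 2 := by nlinarith only [hN1, hNL]
  have hE2 : E ≤ 14 * L ^ 2 := by
    have := Nat.mul_le_mul_right (8 * L + 10) hML
    rw [hE]
    nlinarith only [this, hL2]
  -- All phases cost `O((e + 2) ^ 3)`, so this quadratic bound yields the exponent `6`.
  have he2 : e + 2 ≤ 42 * L ^ 2 := by nlinarith only [he, hE2, hL2, hN1, hNL]
  have q2 : K₂ * (e + 2) ^ 2 ≤ K₂ * (e + 2) ^ 3 := by gcongr <;> omega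
  have q3 : K₃ * (M * (8 * L + 10) + 1) * (E + 2) ^ 2 ≤ K₃ * (e + 2) * (e + 2) ^ 2 := by
    gcongr <;> omega
  have q : (K₁ + K₂ + K₃ + K₄ + K₅) * (e + 2) ^ 3 ≤
    (K₁ + K₂ + K₃ + K₄ + K₅) * (42 * L ^ 2) ^ 3 := by gcongr
  calc _ ≤ K₁ * (e + 2) ^ 3 + K₂ * (e + 2) ^ 3 + K₃ * (e + 2) * (e + 2) ^ 2 +
        K₄ * (e + 2) ^ 3 + K₅ * (e + 2) ^ 3 := by omega
    _ = (K₁ + K₂ + K₃ + K₄ + K₅) * (e + 2) ^ 3 := by ring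
    _ ≤ _ := q
    _ = _ := by ring

/-! ### Coefficients in `ℤ[x] / (x ^ (2 ^ n) + 1)` -/

open Polynomial in
theorem negacyclic_natDegree (n : ℕ) : (X ^ 2 ^ n + 1 : ℤ[X]).natDegree = 2 ^ n := by
  simpa using natDegree_X_pow_add_C (n := 2 ^ n) (r := (1 : ℤ))

/-- The class of `x`. -/
noncomputable abbrev xRoot (n : ℕ) : NegacyclicRing n := AdjoinRoot.root _

theorem xRoot_pow (n : ℕ) : xRoot n ^ 2 ^ n = -1 := by
  have := AdjoinRoot.mk_self (f := (Polynomial.X ^ 2 ^ n + 1 : Polynomial ℤ))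
  rw [map_add, map_pow, map_one, AdjoinRoot.mk_X] at this
  exact eq_neg_of_add_eq_zero_left this

/-- `ringCoeff` as an additive map. -/
noncomputable def ringCoeffHom (n i : ℕ) : NegacyclicRing n →ₗ[ℤ] ℤ :=
  Polynomial.lcoeff ℤ i ∘ₗ AdjoinRoot.modByMonicHom (negacyclic_monic n)

theorem ringCoeffHom_apply (n i : ℕ) (z : NegacyclicRing n) :
    ringCoeffHom n i z = ringCoeff n z i := rfl

theorem ringCoeff_xRoot_pow {n i j : ℕ} (hj : j < 2 ^ n) :
    ringCoeff n (xRoot n ^ j) i = if i = j then 1 else 0 := by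
  rw [ringCoeff, xRoot, ← AdjoinRoot.mk_X, ← map_pow, AdjoinRoot.modByMonicHom_mk,
    (Polynomial.modByMonic_eq_self_iff (negacyclic_monic n)).2, Polynomial.coeff_X_pow]
  rw [Polynomial.degree_eq_natDegree (negacyclic_monic n).ne_zero, negacyclic_natDegree,
    Polynomial.degree_X_pow]
  exact_mod_cast hj

theorem ringCoeff_intCast_mul (n : ℕ) (c : ℤ) (r : NegacyclicRing n) (i : ℕ) :
    ringCoeff n (c * r) i = c * ringCoeff n r i := by
  rw [← ringCoeffHom_apply, ← zsmul_eq_mul, map_zsmul, ringCoeffHom_apply, smul_eq_mul]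

theorem ringCoeff_sum {n : ℕ} (c : ℕ → ℤ) {i : ℕ} (hi : i < 2 ^ n) :
    ringCoeff n (∑ j ∈ Finset.range (2 ^ n), c j * xRoot n ^ j) i = c i := by
  rw [← ringCoeffHom_apply, map_sum]
  simp only [ringCoeffHom_apply, ringCoeff_intCast_mul]
  rw [Finset.sum_congr rfl fun j hj => by rw [ringCoeff_xRoot_pow (Finset.mem_range.1 hj)]]
  simp [hi]

theorem sum_ringCoeff (n : ℕ) (r : NegacyclicRing n) :
    ∑ i ∈ Finset.range (2 ^ n), (ringCoeff n r i : NegacyclicRing n) * xRoot n ^ i = r := by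
  conv_rhs => rw [← AdjoinRoot.mk_leftInverse (negacyclic_monic n) r]
  set P := AdjoinRoot.modByMonicHom (negacyclic_monic n) r with hP
  have hdeg : P.natDegree < 2 ^ n := by
    obtain ⟨Q, rfl⟩ := AdjoinRoot.mk_surjective r
    rw [hP, AdjoinRoot.modByMonicHom_mk]
    refine (Polynomial.natDegree_modByMonic_lt _ (negacyclic_monic n) ?_).trans_eq
      (negacyclic_natDegree n)
    intro h
    have := negacyclic_natDegree n
    rw [h, Polynomial.natDegree_one] at this
    exact (pow_pos two_pos n).ne this
  rw [P.as_sum_range' _ hdeg, map_sum]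
  refine Finset.sum_congr rfl fun i _ => ?_
  rw [← Polynomial.C_mul_X_pow_eq_monomial, map_mul, map_pow, AdjoinRoot.mk_X]
  rw [ringCoeff, ← hP]
  simp

theorem ringCoeff_intCast_zero (n : ℕ) (c : ℤ) : ringCoeff n c 0 = c := by
  have := ringCoeff_intCast_mul n c (xRoot n ^ 0) 0
  rwa [ringCoeff_xRoot_pow (by positivity), pow_zero, mul_one, if_pos rfl, mul_one] at this

/-- The squared length of the coefficient vector. -/
noncomputable def coeffSq (n : ℕ) (r : NegacyclicRing n) : ℤ :=
  ∑ i ∈ Finset.range (2 ^ n), ringCoeff n r i ^ 2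

theorem norm_coeffEmbedding_le {n : ℕ} {v w : NegacyclicRing n} (h : coeffSq n v ≤ coeffSq n w) :
    ‖coeffEmbedding n v‖ ≤ ‖coeffEmbedding n w‖ := by
  have key : ∀ r : NegacyclicRing n, ‖coeffEmbedding n r‖ = √(coeffSq n r : ℤ) := fun r => by
    rw [EuclideanSpace.norm_eq, coeffSq, Finset.sum_range]
    simp [coeffEmbedding]
  rw [key, key]
  exact Real.sqrt_le_sqrt (by exact_mod_cast h)

/-! ### The ring as an extension of `Z8` -/

theorem two_pow_eq {n : ℕ} (hn : 2 ≤ n) : 2 ^ n = 4 * (2 ^ n / 4) := by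
  obtain ⟨k, rfl⟩ := Nat.exists_eq_add_of_le hn
  rw [pow_add]
  omega

theorem sum_range_two_pow {M : Type*} [AddCommMonoid M] {n : ℕ} (hn : 2 ≤ n) (f : ℕ → M) :
    ∑ i ∈ Finset.range (2 ^ n), f i = ∑ k ∈ Finset.range (2 ^ n / 4),
      (f k + f (k + 2 ^ n / 4) + f (k + 2 * (2 ^ n / 4)) + f (k + 3 * (2 ^ n / 4))) := by
  conv_lhs => rw [two_pow_eq hn]
  generalize 2 ^ n / 4 = q
  rw [show 4 * q = q + q + q + q by ring, Finset.sum_range_add, Finset.sum_range_add,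
    Finset.sum_range_add, Finset.sum_add_distrib, Finset.sum_add_distrib, Finset.sum_add_distrib]
  congr 1
  · congr 1
    · congr 1
      exact Finset.sum_congr rfl fun k _ => by rw [add_comm]
    · exact Finset.sum_congr rfl fun k _ => by congr 1; ring
  · exact Finset.sum_congr rfl fun k _ => by congr 1; ring

/-- The quadruple of the coefficients of `r` at `k`, `k + q`, `k + 2 q`, `k + 3 q`, where `q` is a
quarter of the dimension. -/
noncomputable def component (n k : ℕ) (r : NegacyclicRing n) : Z8 :=
  ⟨ringCoeff n r k, ringCoeff n r (k + 2 ^ n / 4), ringCoeff n r (k + 2 * (2 ^ n / 4)),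
    ringCoeff n r (k + 3 * (2 ^ n / 4))⟩

theorem coeffSq_eq_sum {n : ℕ} (hn : 2 ≤ n) (r : NegacyclicRing n) :
    coeffSq n r = ∑ k ∈ Finset.range (2 ^ n / 4), (component n k r).sqLen := by
  rw [coeffSq, sum_range_two_pow hn]
  rfl

theorem xRoot_quarter_pow {n : ℕ} (hn : 2 ≤ n) : (xRoot n ^ (2 ^ n / 4)) ^ 4 = -1 := by
  rw [← pow_mul, mul_comm, ← two_pow_eq hn, xRoot_pow]

/-- The embedding of `Z8` that sends `ζ` to `x ^ (2 ^ n / 4)`. -/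
noncomputable def fromZ8 {n : ℕ} (hn : 2 ≤ n) : Z8 →+* NegacyclicRing n where
  toFun z := z.c0 + z.c1 * xRoot n ^ (2 ^ n / 4) + z.c2 * (xRoot n ^ (2 ^ n / 4)) ^ 2 +
    z.c3 * (xRoot n ^ (2 ^ n / 4)) ^ 3
  map_one' := by simp
  map_zero' := by simp
  map_add' z w := by simp; ring
  map_mul' z w := by
    have h := xRoot_quarter_pow hn
    generalize xRoot n ^ (2 ^ n / 4) = y at h
    simp only [Z8.mul_c0, Z8.mul_c1, Z8.mul_c2, Z8.mul_c3]
    push_cast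
    linear_combination (-(z.c1 * w.c3 : NegacyclicRing n) - z.c2 * w.c2 - z.c3 * w.c1 -
      (z.c2 * w.c3 + z.c3 * w.c2) * y - z.c3 * w.c3 * y ^ 2) * h

theorem fromZ8_apply {n : ℕ} (hn : 2 ≤ n) (z : Z8) : fromZ8 hn z =
    z.c0 + z.c1 * xRoot n ^ (2 ^ n / 4) + z.c2 * (xRoot n ^ (2 ^ n / 4)) ^ 2 +
    z.c3 * (xRoot n ^ (2 ^ n / 4)) ^ 3 := rfl

theorem sum_component {n : ℕ} (hn : 2 ≤ n) (r : NegacyclicRing n) :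
    ∑ k ∈ Finset.range (2 ^ n / 4), xRoot n ^ k * fromZ8 hn (component n k r) = r := by
  conv_rhs => rw [← sum_ringCoeff n r, sum_range_two_pow hn]
  refine Finset.sum_congr rfl fun k _ => ?_
  rw [fromZ8_apply, component]
  ring

theorem component_sum {n : ℕ} (hn : 2 ≤ n) (w : ℕ → Z8) {k : ℕ} (hk : k < 2 ^ n / 4) :
    component n k (∑ j ∈ Finset.range (2 ^ n / 4), xRoot n ^ j * fromZ8 hn (w j)) = w k := by
  have h4 := two_pow_eq hn
  have hq : 0 < 2 ^ n / 4 := by omega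
  -- Position `j + a q` with `j < q` holds coefficient `a` of `w j`.
  set c : ℕ → ℤ := fun i => if i / (2 ^ n / 4) = 0 then (w (i % (2 ^ n / 4))).c0 else
    if i / (2 ^ n / 4) = 1 then (w (i % (2 ^ n / 4))).c1 else
    if i / (2 ^ n / 4) = 2 then (w (i % (2 ^ n / 4))).c2 else (w (i % (2 ^ n / 4))).c3 with hc
  have key : ∀ j < 2 ^ n / 4, ∀ a, (j + a * (2 ^ n / 4)) / (2 ^ n / 4) = a ∧
      (j + a * (2 ^ n / 4)) % (2 ^ n / 4) = j := fun j hj a => by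
    rw [Nat.add_mul_div_right _ _ hq, Nat.add_mul_mod_self_right, Nat.div_eq_of_lt hj,
      Nat.mod_eq_of_lt hj, zero_add]
    exact ⟨rfl, rfl⟩
  have e0 : ∀ j < 2 ^ n / 4, c j = (w j).c0 := fun j hj => by
    have h := key j hj 0
    rw [zero_mul, add_zero] at h
    simp only [hc, h.1, h.2, if_true]
  have e1 : ∀ j < 2 ^ n / 4, c (j + 2 ^ n / 4) = (w j).c1 := fun j hj => by
    have h := key j hj 1
    rw [one_mul] at h
    simp only [hc, h.1, h.2, if_true, one_ne_zero, if_false]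
  have e2 : ∀ j < 2 ^ n / 4, c (j + 2 * (2 ^ n / 4)) = (w j).c2 := fun j hj => by
    simp only [hc, (key j hj 2).1, (key j hj 2).2]
    rfl
  have e3 : ∀ j < 2 ^ n / 4, c (j + 3 * (2 ^ n / 4)) = (w j).c3 := fun j hj => by
    simp only [hc, (key j hj 3).1, (key j hj 3).2]
    rfl
  have : ∑ j ∈ Finset.range (2 ^ n / 4), xRoot n ^ j * fromZ8 hn (w j) =
      ∑ i ∈ Finset.range (2 ^ n), (c i : NegacyclicRing n) * xRoot n ^ i := by
    rw [sum_range_two_pow hn]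
    refine Finset.sum_congr rfl fun j hj => ?_
    rw [Finset.mem_range] at hj
    rw [e0 j hj, e1 j hj, e2 j hj, e3 j hj, fromZ8_apply]
    ring
  rw [this, component, ringCoeff_sum _ (by omega), ringCoeff_sum _ (by omega),
    ringCoeff_sum _ (by omega), ringCoeff_sum _ (by omega), e0 k hk, e1 k hk, e2 k hk, e3 k hk]

theorem component_fromZ8_mul {n : ℕ} (hn : 2 ≤ n) (z : Z8) (r : NegacyclicRing n) {k : ℕ}
    (hk : k < 2 ^ n / 4) : component n k (fromZ8 hn z * r) = z * component n k r := by
  have : fromZ8 hn z * r = ∑ j ∈ Finset.range (2 ^ n / 4),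
      xRoot n ^ j * fromZ8 hn (z * component n j r) := by
    conv_lhs => rw [← sum_component hn r]
    rw [Finset.mul_sum]
    refine Finset.sum_congr rfl fun j _ => ?_
    rw [map_mul]
    ring
  rw [this, component_sum hn (fun j => z * component n j r) hk]

theorem component_add (n k : ℕ) (r s : NegacyclicRing n) :
    component n k (r + s) = component n k r + component n k s := by
  simp only [component, ← ringCoeffHom_apply, map_add]
  rfl

theorem component_zero (n k : ℕ) : component n k 0 = 0 := by
  simp only [component, ← ringCoeffHom_apply, map_zero]
  rfl

/-- Freeness over `Z8`: the extension of `J` is the direct sum of the `x ^ k J` for `k < q`. -/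
theorem mem_map_fromZ8_iff {n : ℕ} (hn : 2 ≤ n) {J : Ideal Z8} {r : NegacyclicRing n} :
    r ∈ J.map (fromZ8 hn) ↔ ∀ k < 2 ^ n / 4, component n k r ∈ J := by
  constructor
  · intro hr
    -- Multiplication by `x` mixes the components, so the claim is proved for all multiples of `r`
    -- at once; the scalar case of the induction is then immediate.
    suffices ∀ a, ∀ k < 2 ^ n / 4, component n k (a * r) ∈ J by simpa using this 1
    induction hr using Submodule.span_induction with
    | mem r hr =>
      obtain ⟨z, hz, rfl⟩ := hr
      intro a k hk
      rw [mul_comm, component_fromZ8_mul hn _ _ hk]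
      exact J.mul_mem_right _ hz
    | zero => intro a k _; rw [mul_zero, component_zero]; exact J.zero_mem
    | add r s _ _ h1 h2 =>
      intro a k hk
      rw [mul_add, component_add]
      exact J.add_mem (h1 a k hk) (h2 a k hk)
    | smul b r _ h =>
      intro a k hk
      rw [smul_eq_mul, ← mul_assoc]
      exact h _ k hk
  · intro h
    rw [← sum_component hn r]
    exact Ideal.sum_mem _ fun k hk => Ideal.mul_mem_left _ _
      (Ideal.mem_map_of_mem _ (h k (Finset.mem_range.1 hk)))

theorem map_fromZ8_injective {n : ℕ} (hn : 2 ≤ n) :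
    Function.Injective (Ideal.map (fromZ8 hn)) := by
  have hq : 0 < 2 ^ n / 4 := by have := two_pow_eq hn; have := Nat.two_pow_pos n; omega
  have h1 : component n 0 1 = 1 := by
    have := component_sum hn (fun k => if k = 0 then 1 else 0) hq
    rwa [Finset.sum_eq_single_of_mem 0 (by simpa using hq) (by intro k _ hk; simp [hk]), if_pos rfl,
      pow_zero, map_one, mul_one] at this
  have key : ∀ J J' : Ideal Z8, J.map (fromZ8 hn) ≤ J'.map (fromZ8 hn) → J ≤ J' := by
    intro J J' h z hz
    have := (mem_map_fromZ8_iff hn).1 (h (Ideal.mem_map_of_mem _ hz)) 0 hq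
    rwa [← mul_one (fromZ8 hn z), component_fromZ8_mul hn _ _ hq, h1, mul_one] at this
  exact fun J J' h => le_antisymm (key _ _ h.le) (key _ _ h.ge)

/-- If an ideal is extended from `Z8`, then the components of its generators generate the ideal it
is extended from. -/
theorem span_component {n : ℕ} (hn : 2 ≤ n) {J : Ideal Z8} {S : Set (NegacyclicRing n)}
    (h : Ideal.span S = J.map (fromZ8 hn)) :
    Ideal.span {z | ∃ g ∈ S, ∃ k < 2 ^ n / 4, z = component n k g} = J := by
  -- It suffices to compare the extended ideals: the components of members of `S` lie in `J`, and
  -- each member is recovered from its components.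
  apply map_fromZ8_injective hn
  apply le_antisymm
  · apply Ideal.map_mono
    rw [Ideal.span_le]
    rintro z ⟨g, hg, k, hk, rfl⟩
    exact (mem_map_fromZ8_iff hn).1 (h ▸ Ideal.subset_span hg) k hk
  · rw [← h, Ideal.span_le]
    intro g hg
    exact (mem_map_fromZ8_iff hn).2 fun k hk => Ideal.subset_span ⟨g, hg, k, hk, rfl⟩

/-- Some component of a competitor is a nonzero multiple of `z`, hence at least as long as `z`; the
other components only add to the length. -/
theorem isShortestVector_fromZ8 {n : ℕ} (hn : 2 ≤ n) {z : Z8} (hz : z ≠ 0)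
    (hred : 4 * z.cross ^ 2 ≤ z.sqLen ^ 2) :
    IsShortestVector n ((Ideal.span {z}).map (fromZ8 hn)) (fromZ8 hn z) := by
  have hq : 0 < 2 ^ n / 4 := by have := two_pow_eq hn; have := Nat.two_pow_pos n; omega
  have hcomp : ∀ k < 2 ^ n / 4, component n k (fromZ8 hn z) = if k = 0 then z else 0 := by
    intro k hk
    have := component_sum hn (fun k => if k = 0 then z else 0) hk
    rwa [Finset.sum_eq_single_of_mem 0 (by simpa using hq) (by intro k _ hk; simp [hk]), if_pos rfl,
      pow_zero, one_mul] at this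
  refine ⟨Ideal.mem_map_of_mem _ (Ideal.mem_span_singleton_self z), fun h => hz ?_,
    fun w hw hw0 => norm_coeffEmbedding_le ?_⟩
  · have := hcomp 0 hq
    rwa [h, component_zero, if_pos rfl, eq_comm] at this
  · rw [coeffSq_eq_sum hn, coeffSq_eq_sum hn,
      Finset.sum_congr rfl fun k hk => by rw [hcomp k (Finset.mem_range.1 hk)],
      Finset.sum_eq_single_of_mem 0 (by simpa using hq)
        (by intro k _ hk; simp [hk, Z8.sqLen]), if_pos rfl]
    obtain ⟨k, hk, hk0⟩ : ∃ k < 2 ^ n / 4, component n k w ≠ 0 := by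
      by_contra! h
      apply hw0
      rw [← sum_component hn w]
      exact Finset.sum_eq_zero fun k hk => by
        rw [h k (Finset.mem_range.1 hk), map_zero, mul_zero]
    obtain ⟨u, hu⟩ := Ideal.mem_span_singleton.1 ((mem_map_fromZ8_iff hn).1 hw k hk)
    calc z.sqLen ≤ (component n k w).sqLen := by
          rw [hu]
          exact Z8.sqLen_le_sqLen_mul hred fun h => hk0 (by rw [hu, h, mul_zero])
      _ ≤ _ := Finset.single_le_sum (f := fun k => (component n k w).sqLen)
          (fun k _ => Z8.sqLen_nonneg _) (Finset.mem_range.2 hk)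

theorem ringCoeff_fromZ8 {n : ℕ} (hn : 2 ≤ n) (z : Z8) {i : ℕ} (hi : i < 2 ^ n) :
    ringCoeff n (fromZ8 hn z) i = outCoeff n z i := by
  have h4 := two_pow_eq hn
  rw [fromZ8_apply, ← pow_mul, ← pow_mul, ← ringCoeffHom_apply, map_add, map_add, map_add]
  simp only [ringCoeffHom_apply, ringCoeff_intCast_mul]
  rw [ringCoeff_xRoot_pow (by omega), ringCoeff_xRoot_pow (by omega),
    ringCoeff_xRoot_pow (by omega), ← mul_one (z.c0 : NegacyclicRing n), ringCoeff_intCast_mul,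
    ← pow_zero (xRoot n), ringCoeff_xRoot_pow (by omega), outCoeff]
  split_ifs <;> omega

/-! ### Primes over `p ≡ ±3 (mod 8)` are extended from `Z8` -/

/-- This is an exact 2-adic valuation: `p ^ 2 - 1` is `8` times an odd number in both residue
classes, and each further squaring adds one factor `2`. -/
theorem exists_pow_two_pow_eq {p : ℤ} (hp : p % 8 = 3 ∨ p % 8 = 5) (k : ℕ) :
    ∃ u : ℤ, p ^ 2 ^ (k + 1) = 1 + 2 ^ (k + 3) * (2 * u + 1) := by
  induction k with
  | zero =>
    rcases hp with h | h
    · obtain ⟨a, rfl⟩ : ∃ a, p = 8 * a + 3 := ⟨p / 8, by omega⟩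
      exact ⟨4 * a ^ 2 + 3 * a, by ring⟩
    · obtain ⟨a, rfl⟩ : ∃ a, p = 8 * a + 5 := ⟨p / 8, by omega⟩
      exact ⟨4 * a ^ 2 + 5 * a + 1, by ring⟩
  | succ k ih =>
    obtain ⟨u, hu⟩ := ih
    refine ⟨u + 2 ^ (k + 1) * (2 * u + 1) ^ 2, ?_⟩
    rw [pow_succ 2 (k + 1), pow_mul, hu]
    ring

theorem orderOf_of_mod_eight {p n : ℕ} (hn : 2 ≤ n) (hp : p % 8 = 3 ∨ p % 8 = 5)
    (x : (ZMod (2 ^ (n + 1)))ˣ) (hx : (x : ZMod (2 ^ (n + 1))) = p) :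
    orderOf x = 2 ^ (n - 1) := by
  obtain ⟨k, rfl⟩ := Nat.exists_eq_add_of_le' hn
  have hp' : (p : ℤ) % 8 = 3 ∨ (p : ℤ) % 8 = 5 := by omega
  have key : ∀ j : ℕ, x ^ j = 1 ↔ (2 : ℤ) ^ (k + 3) ∣ (p : ℤ) ^ j - 1 := fun j => by
    rw [← Units.val_inj, Units.val_pow_eq_pow_val, hx, Units.val_one,
      show (2 : ℤ) ^ (k + 3) = ((2 ^ (k + 2 + 1) : ℕ) : ℤ) by push_cast; ring,
      ← ZMod.intCast_zmod_eq_zero_iff_dvd, Int.cast_sub, sub_eq_zero]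
    push_cast
    rfl
  have : Fact (Nat.Prime 2) := ⟨Nat.prime_two⟩
  have := orderOf_eq_prime_pow (x := x) (p := 2) (n := k) ?_ ?_
  · simpa using this
  · rw [key]
    rcases k with _ | k
    · rw [pow_zero, pow_one]; omega
    · obtain ⟨u, hu⟩ := exists_pow_two_pow_eq hp' k
      rw [hu, add_sub_cancel_left, pow_succ (2 : ℤ) (k + 1 + 2)]
      rintro ⟨v, hv⟩
      rw [show k + 1 + 2 = k + 3 by ring, mul_assoc] at hv
      have := mul_left_cancel₀ (by positivity) hv
      omega
  · rw [key]
    obtain ⟨u, hu⟩ := exists_pow_two_pow_eq hp' k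
    rw [hu, add_sub_cancel_left]
    exact dvd_mul_right _ _

/-- If `a² ≡ -2`, then `y⁴ + 1 ≡ (y² + a y - 1)(y² - a y - 1)` modulo `p`; if `a² ≡ -1`, it is `(y²
+ a)(y² - a)`. As `y⁴ + 1 = 0`, the prime contains a factor. -/
theorem exists_quadratic_mem {n : ℕ} (hn : 2 ≤ n) {𝔭 : Ideal (NegacyclicRing n)} (h𝔭 : 𝔭.IsPrime)
    {p : ℕ} (hp : p.Prime) (h8 : p % 8 = 3 ∨ p % 8 = 5) (hmem : (p : NegacyclicRing n) ∈ 𝔭) :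
    ∃ a b : ℤ, fromZ8 hn ⟨b, a, 1, 0⟩ ∈ 𝔭 := by
  have : Fact p.Prime := ⟨hp⟩
  have hdvd : ∀ {c : ℤ} (z : Z8), (p : ℤ) ∣ c → fromZ8 hn (z * ⟨c, 0, 0, 0⟩) ∈ 𝔭 := by
    rintro _ z ⟨d, rfl⟩
    rw [map_mul, fromZ8_apply hn ⟨_, 0, 0, 0⟩]
    simp only [Int.cast_zero, zero_mul, add_zero, Int.cast_mul, Int.cast_natCast]
    exact 𝔭.mul_mem_left _ (𝔭.mul_mem_right _ hmem)
  rcases h8 with h | h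
  · obtain ⟨u, hu⟩ := (ZMod.exists_sq_eq_neg_two_iff (p := p) (by omega)).2 (Or.inr h)
    obtain ⟨a, rfl⟩ := ZMod.intCast_surjective u
    have hd : (p : ℤ) ∣ -(a ^ 2 + 2) := by
      rw [dvd_neg, ← ZMod.intCast_zmod_eq_zero_iff_dvd]
      push_cast
      linear_combination -hu
    have := hdvd ⟨0, 0, 1, 0⟩ hd
    rw [show (⟨0, 0, 1, 0⟩ * ⟨-(a ^ 2 + 2), 0, 0, 0⟩ : Z8) = ⟨-1, a, 1, 0⟩ * ⟨-1, -a, 1, 0⟩ by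
      ext <;> simp; ring, map_mul] at this
    rcases h𝔭.mem_or_mem this with h' | h'
    · exact ⟨_, _, h'⟩
    · exact ⟨_, _, h'⟩
  · obtain ⟨u, hu⟩ := (ZMod.exists_sq_eq_neg_one_iff (p := p)).2 (by omega)
    obtain ⟨a, rfl⟩ := ZMod.intCast_surjective u
    have hd : (p : ℤ) ∣ -(a ^ 2 + 1) := by
      rw [dvd_neg, ← ZMod.intCast_zmod_eq_zero_iff_dvd]
      push_cast
      linear_combination -hu
    have := hdvd 1 hd
    rw [show (1 * ⟨-(a ^ 2 + 1), 0, 0, 0⟩ : Z8) = ⟨a, 0, 1, 0⟩ * ⟨-a, 0, 1, 0⟩ by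
      ext <;> simp; ring, map_mul] at this
    rcases h𝔭.mem_or_mem this with h' | h'
    · exact ⟨_, _, h'⟩
    · exact ⟨_, _, h'⟩

open Polynomial in
-- `X ^ 2 ^ n + 1` is the cyclotomic polynomial of index `2 ^ (n + 1)`; the degree of its
-- irreducible factors over `ZMod p` is the order of `p` modulo that index.
theorem natDegree_minpoly_xRoot {n : ℕ} (hn : 2 ≤ n) {p : ℕ} [Fact p.Prime]
    (h8 : p % 8 = 3 ∨ p % 8 = 5) {k : Type*} [CommRing k] [IsDomain k] [Algebra (ZMod p) k] {x : k}
    (hx : x ^ 2 ^ n = -1) :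
    (minpoly (ZMod p) x).natDegree = 2 ^ (n - 1) ∧ IsIntegral (ZMod p) x := by
  have hcyc : cyclotomic (2 ^ (n + 1)) (ZMod p) = X ^ 2 ^ n + 1 := by
    rw [cyclotomic_prime_pow_eq_geom_sum Nat.prime_two]
    simp [Finset.sum_range_succ, add_comm]
  have h0 : aeval x (X ^ 2 ^ n + 1 : (ZMod p)[X]) = 0 := by simp [hx]
  have hint : IsIntegral (ZMod p) x := by
    refine ⟨X ^ 2 ^ n + 1, ?_, h0⟩
    simpa using monic_X_pow_add_C (1 : ZMod p) (pow_ne_zero n two_ne_zero)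
  have hcop : p.Coprime (2 ^ (n + 1)) := by
    apply Nat.Coprime.pow_right
    rw [Nat.coprime_two_right]
    exact Nat.odd_iff.2 (by omega)
  refine ⟨?_, hint⟩
  rw [natDegree_of_dvd_cyclotomic_of_irreducible (p := p) (f := 1) (n := 2 ^ (n + 1)) (by simp)
    hcop (hcyc ▸ minpoly.dvd _ _ h0) (minpoly.irreducible hint)]
  exact orderOf_of_mod_eight hn h8 _ (by simp)

open Polynomial in
theorem exists_eq_map_fromZ8_of_isPrime {n : ℕ} (hn : 2 ≤ n) {𝔭 : Ideal (NegacyclicRing n)}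
    (h𝔭 : 𝔭.IsPrime) {p : ℕ} (hp : p.Prime) (h8 : p % 8 = 3 ∨ p % 8 = 5)
    (hmem : (p : NegacyclicRing n) ∈ 𝔭) : ∃ J : Ideal Z8, 𝔭 = J.map (fromZ8 hn) := by
  have : Fact p.Prime := ⟨hp⟩
  obtain ⟨a, b, hab⟩ := exists_quadratic_mem hn h𝔭 hp h8 hmem
  refine ⟨𝔭.comap (fromZ8 hn), le_antisymm (fun r hr => ?_) Ideal.map_comap_le⟩
  have hpmem : (p : NegacyclicRing n) ∈ (𝔭.comap (fromZ8 hn)).map (fromZ8 hn) := by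
    rw [← map_natCast (fromZ8 hn)]
    exact Ideal.mem_map_of_mem _ (by rwa [Ideal.mem_comap, map_natCast])
  have hfmem := Ideal.mem_map_of_mem (fromZ8 hn) (Ideal.mem_comap.2 hab)
  have hchar : CharP (NegacyclicRing n ⧸ 𝔭) p := by
    have h0 : (p : NegacyclicRing n ⧸ 𝔭) = 0 := by
      rw [← map_natCast (Ideal.Quotient.mk 𝔭), Ideal.Quotient.eq_zero_iff_mem]
      exact hmem
    exact ringChar.of_eq (CharP.ringChar_of_prime_eq_zero hp h0)
  let _ : Algebra (ZMod p) (NegacyclicRing n ⧸ 𝔭) := ZMod.algebra _ p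
  set x : NegacyclicRing n ⧸ 𝔭 := Ideal.Quotient.mk 𝔭 (xRoot n) with hxdef
  have hx : x ^ 2 ^ n = -1 := by rw [hxdef, ← map_pow, xRoot_pow, map_neg, map_one]
  obtain ⟨hdeg, hint⟩ := natDegree_minpoly_xRoot hn (p := p) h8 hx
  have haeval : ∀ P : ℤ[X], aeval x (P.map (Int.castRingHom (ZMod p))) =
      Ideal.Quotient.mk 𝔭 (AdjoinRoot.mk _ P) := by
    intro P
    suffices ((aeval x).toRingHom.comp (mapRingHom (Int.castRingHom (ZMod p)))) =
        (Ideal.Quotient.mk 𝔭).comp (AdjoinRoot.mk (X ^ 2 ^ n + 1)) from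
      DFunLike.congr_fun this P
    apply ringHom_ext
    · intro c; simp
    · simp [hxdef]
  set q := 2 ^ n / 4 with hq
  have h4 : 2 ^ n = 4 * q := two_pow_eq hn
  have hq0 : 0 < q := by have := Nat.two_pow_pos n; omega
  have hhalf : 2 ^ (n - 1) = q * 2 := by
    have : 2 ^ n = 2 ^ (n - 1) * 2 := by rw [← pow_succ]; congr 1; omega
    omega
  set f : ℤ[X] := X ^ (q * 2) + (C a * X ^ q + C b) with hf
  have hlow : (C a * X ^ q + C b : ℤ[X]).degree < (q * 2 : ℕ) := by
    refine (degree_add_le _ _).trans_lt (max_lt ?_ ?_)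
    · exact (degree_C_mul_X_pow_le _ _).trans_lt (by exact_mod_cast (by omega : q < q * 2))
    · exact degree_C_le.trans_lt (by exact_mod_cast (by omega : 0 < q * 2))
  have hfm : f.Monic := monic_X_pow_add hlow
  have hfd : f.natDegree = q * 2 := by
    rw [hf, natDegree_add_eq_left_of_degree_lt (by rwa [degree_X_pow]), natDegree_X_pow]
  have hfφ : AdjoinRoot.mk (X ^ 2 ^ n + 1) f = fromZ8 hn ⟨b, a, 1, 0⟩ := by
    rw [hf, fromZ8_apply, ← hq]
    simp [pow_mul]
    ring
  -- The minimal polynomial divides the reduction of `f`, and both are monic of degree `2 q = 2 ^ (n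
  -- - 1)`.
  have hmin : f.map (Int.castRingHom (ZMod p)) = minpoly (ZMod p) x := by
    apply eq_of_monic_of_dvd_of_natDegree_le (minpoly.monic hint) (hfm.map _)
    · apply minpoly.dvd
      rw [haeval, hfφ, Ideal.Quotient.eq_zero_iff_mem]
      exact hab
    · rw [hfm.natDegree_map, hfd, hdeg, hhalf]
  obtain ⟨P, rfl⟩ := AdjoinRoot.mk_surjective r
  have hdvd : f.map (Int.castRingHom (ZMod p)) ∣ P.map (Int.castRingHom (ZMod p)) := by
    rw [hmin]
    apply minpoly.dvd
    rw [haeval, Ideal.Quotient.eq_zero_iff_mem]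
    exact hr
  -- Division by the monic `f` over `ℤ` lifts the divisibility modulo `p`: an element of the prime
  -- is a multiple of `f` plus a multiple of `p`.
  have hrem : C (p : ℤ) ∣ P %ₘ f := by
    rw [C_dvd_iff_dvd_coeff]
    intro i
    rw [← ZMod.intCast_zmod_eq_zero_iff_dvd, ← eq_intCast (Int.castRingHom (ZMod p)), ← coeff_map,
      map_modByMonic _ hfm, (modByMonic_eq_zero_iff_dvd (hfm.map _)).2 hdvd, coeff_zero]
  obtain ⟨S, hS⟩ := hrem
  rw [← modByMonic_add_div P f, hS, map_add, map_mul, map_mul, hfφ]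
  refine Ideal.add_mem _ (Ideal.mul_mem_right _ _ ?_) (Ideal.mul_mem_right _ _ hfmem)
  simpa using hpmem

theorem exists_eq_map_fromZ8_of_prod {n : ℕ} (hn : 2 ≤ n) {ι : Type*} [Fintype ι]
    {𝔭 : ι → Ideal (NegacyclicRing n)} (h : ∀ i, ∃ J : Ideal Z8, 𝔭 i = J.map (fromZ8 hn)) :
    ∃ J : Ideal Z8, ∏ i, 𝔭 i = J.map (fromZ8 hn) := by
  refine Finset.prod_induction _ (fun I => ∃ J : Ideal Z8, I = J.map (fromZ8 hn)) ?_ ?_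
    fun i _ => h i
  · rintro _ _ ⟨J, rfl⟩ ⟨J', rfl⟩
    exact ⟨J * J', (Ideal.map_mul _ _ _).symm⟩
  · exact ⟨⊤, by rw [Ideal.map_top, Ideal.one_eq_top]⟩

/-! ### Dimension two -/

/-- The image of `r = a + b x`, `x ^ 2 = -1`, under `x ↦ ζ ^ 2`. -/
noncomputable def gaussToZ8 (r : NegacyclicRing 1) : Z8 :=
  ⟨ringCoeff 1 r 0, 0, ringCoeff 1 r 1, 0⟩

/-- The projection to the even coefficients. -/
noncomputable def gaussOfZ8 (z : Z8) : NegacyclicRing 1 := z.c0 + z.c2 * xRoot 1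

theorem gaussOfZ8_toZ8 (r : NegacyclicRing 1) : gaussOfZ8 (gaussToZ8 r) = r := by
  conv_rhs => rw [← sum_ringCoeff 1 r]
  simp [gaussOfZ8, gaussToZ8, Finset.sum_range_succ]

theorem ringCoeff_gaussOfZ8 (z : Z8) :
    ringCoeff 1 (gaussOfZ8 z) 0 = z.c0 ∧ ringCoeff 1 (gaussOfZ8 z) 1 = z.c2 := by
  have h := fun i hi => ringCoeff_sum (n := 1) (fun i => if i = 0 then z.c0 else z.c2) (i := i) hi
  simp only [pow_one, Finset.sum_range_succ, Finset.range_zero, Finset.sum_empty, zero_add,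
    pow_zero, mul_one, if_true, one_ne_zero, if_false] at h
  exact ⟨h 0 (by norm_num), h 1 (by norm_num)⟩

theorem gaussToZ8_ofZ8 {z : Z8} (h1 : z.c1 = 0) (h3 : z.c3 = 0) :
    gaussToZ8 (gaussOfZ8 z) = z := by
  obtain ⟨e0, e2⟩ := ringCoeff_gaussOfZ8 z
  ext <;> simp [gaussToZ8, e0, e2, h1, h3]

theorem gaussOfZ8_mul (z : Z8) (r : NegacyclicRing 1) :
    gaussOfZ8 (z * gaussToZ8 r) = gaussOfZ8 z * r := by
  conv_rhs => rw [← gaussOfZ8_toZ8 r]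
  have h := xRoot_pow 1
  simp only [gaussOfZ8, gaussToZ8, Z8.mul_c0, Z8.mul_c2]
  push_cast
  linear_combination (-(z.c2 * (ringCoeff 1 r 1 : NegacyclicRing 1))) * h

theorem gaussToZ8_mul (r s : NegacyclicRing 1) :
    gaussToZ8 (r * s) = gaussToZ8 r * gaussToZ8 s := by
  rw [← gaussToZ8_ofZ8 (z := gaussToZ8 r * gaussToZ8 s) (by simp [gaussToZ8])
    (by simp [gaussToZ8]), gaussOfZ8_mul, gaussOfZ8_toZ8]

theorem gaussToZ8_add (r s : NegacyclicRing 1) :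
    gaussToZ8 (r + s) = gaussToZ8 r + gaussToZ8 s := by
  simp only [gaussToZ8, ← ringCoeffHom_apply, map_add]
  rfl

theorem gaussOfZ8_add (z w : Z8) : gaussOfZ8 (z + w) = gaussOfZ8 z + gaussOfZ8 w := by
  simp only [gaussOfZ8, Z8.add_c0, Z8.add_c2]
  push_cast
  ring

theorem gaussOfZ8_zero : gaussOfZ8 0 = 0 := by simp [gaussOfZ8]

theorem gaussToZ8_zero : gaussToZ8 0 = 0 := by
  rw [← gaussOfZ8_zero, gaussToZ8_ofZ8 rfl rfl]

/-- No condition on primes is needed: `gaussOfZ8` is a `ℤ[i]`-linear retraction of `gaussToZ8`, so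
the ideal extended to `Z8` retracts onto the original one. An even generator has `cross = 0` and is
therefore already reduced. -/
theorem isShortestVector_gaussOfZ8 {S : Set (NegacyclicRing 1)} {z : Z8} (hz0 : z ≠ 0)
    (hz : Ideal.span {z} = Ideal.span (gaussToZ8 '' S)) (h1 : z.c1 = 0) (h3 : z.c3 = 0) :
    IsShortestVector 1 (Ideal.span S) (gaussOfZ8 z) := by
  have hback : ∀ w ∈ Ideal.span (gaussToZ8 '' S), gaussOfZ8 w ∈ Ideal.span S := by
    intro w hw
    -- `gaussOfZ8` is not multiplicative on `Z8`, so all multiples are treated together.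
    suffices ∀ a, gaussOfZ8 (a * w) ∈ Ideal.span S by simpa using this 1
    induction hw using Submodule.span_induction with
    | mem w hw =>
      obtain ⟨g, hg, rfl⟩ := hw
      intro a
      rw [gaussOfZ8_mul]
      exact Ideal.mul_mem_left _ _ (Ideal.subset_span hg)
    | zero => intro a; rw [mul_zero, gaussOfZ8_zero]; exact Ideal.zero_mem _
    | add v w _ _ hv hw =>
      intro a
      rw [mul_add, gaussOfZ8_add]
      exact Ideal.add_mem _ (hv a) (hw a)
    | smul b w _ hw => intro a; rw [smul_eq_mul, ← mul_assoc]; exact hw _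
  have hforth : ∀ r ∈ Ideal.span S, gaussToZ8 r ∈ Ideal.span {z} := by
    intro r hr
    rw [hz]
    induction hr using Submodule.span_induction with
    | mem r hr => exact Ideal.subset_span ⟨r, hr, rfl⟩
    | zero => rw [gaussToZ8_zero]; exact Ideal.zero_mem _
    | add r s _ _ hr hs => rw [gaussToZ8_add]; exact Ideal.add_mem _ hr hs
    | smul a r _ hr => rw [smul_eq_mul, gaussToZ8_mul]; exact Ideal.mul_mem_left _ _ hr
  have hsq : ∀ r, coeffSq 1 r = (gaussToZ8 r).sqLen := fun r => by
    simp [coeffSq, gaussToZ8, Z8.sqLen, Finset.sum_range_succ]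
  refine ⟨hback z (hz ▸ Ideal.mem_span_singleton_self z), fun h => hz0 ?_,
    fun w hw hw0 => norm_coeffEmbedding_le ?_⟩
  · rw [← gaussToZ8_ofZ8 h1 h3, h, gaussToZ8_zero]
  · obtain ⟨u, hu⟩ := Ideal.mem_span_singleton.1 (hforth w hw)
    rw [hsq, hsq, gaussToZ8_ofZ8 h1 h3, hu]
    refine Z8.sqLen_le_sqLen_mul ?_ fun h => hw0 ?_
    · have : z.cross = 0 := by simp [Z8.cross, h1, h3]
      rw [this]
      nlinarith [sq_nonneg z.sqLen]
    · rw [← gaussOfZ8_toZ8 w, hu, h, mul_zero, gaussOfZ8_zero]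

/-! ### The input -/

theorem List.getD_flatMap_of_length_eq {α β : Type*} (F : α → List β) {N : ℕ}
    (hF : ∀ a, (F a).length = N) (l : List α) {j i : ℕ} (hj : j < l.length) (hi : i < N) (d : β) :
    (l.flatMap F).getD (j * N + i) d = (F l[j]).getD i d := by
  induction l generalizing j with
  | nil => simp at hj
  | cons a l ih =>
    rw [List.flatMap_cons]
    rcases j with _ | j
    · rw [List.getD_append _ _ _ _ (by rw [hF]; omega)]
      simp
    · rw [List.getD_append_right _ _ _ _ (by rw [hF, add_mul]; omega), hF,
        show (j + 1) * N + i - N = j * N + i by rw [add_mul]; omega,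
        ih (by simpa using hj)]
      simp

theorem length_encodeIdeal (n : ℕ) (gens : List (NegacyclicRing n)) :
    (encodeIdeal n gens).length = gens.length * 2 ^ n + 2 := by
  simp [encodeIdeal, List.length_flatMap]

theorem initMem_encodeIdeal {n : ℕ} (gens : List (NegacyclicRing n)) {j i : ℕ}
    (hj : j < gens.length) (hi : i < 2 ^ n) :
    initMem (encodeIdeal n gens) (2 + j * 2 ^ n + i : ℕ) = ringCoeff n gens[j] i := by
  rw [initMem, if_pos (by positivity), Int.toNat_natCast, encodeIdeal,
    show 2 + j * 2 ^ n + i = (j * 2 ^ n + i) + 1 + 1 by ring, List.getD_cons_succ,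
    List.getD_cons_succ, List.getD_flatMap_of_length_eq _ (by simp) _ hj hi]
  simp [hi]

/-- Every entry costs at least one bit; hence the dimension and the number of coefficients are
bounded by the input size. -/
theorem length_le_inputSize (l : List ℤ) : l.length ≤ inputSize l := by
  induction l with
  | nil => simp
  | cons a l ih =>
    have := one_le_bitLen a
    simp only [inputSize, List.map_cons, List.sum_cons, List.length_cons] at ih ⊢
    omega

theorem bitLen_le_inputSize {l : List ℤ} {a : ℤ} (h : a ∈ l) : bitLen a ≤ inputSize l :=
  List.le_sum_of_mem (List.mem_map_of_mem h)

theorem abs_initMem_le (l : List ℤ) (c : ℤ) : |initMem l c| ≤ 2 ^ inputSize l := by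
  have h0 : |(0 : ℤ)| ≤ 2 ^ inputSize l := by simp
  rw [initMem]
  split_ifs
  · by_cases h : c.toNat < l.length
    · rw [List.getD_eq_getElem _ _ h]
      have h1 := bitLen_le_inputSize (List.getElem_mem h)
      have h2 := natAbs_lt_two_pow_bitLen l[c.toNat]
      have h3 : 2 ^ (bitLen l[c.toNat] - 1) ≤ 2 ^ inputSize l :=
        Nat.pow_le_pow_right (by norm_num) (by omega)
      rw [Int.abs_eq_natAbs]
      exact_mod_cast h2.le.trans h3
    · rw [List.getD_eq_default _ _ (by omega)]
      exact h0
  · exact h0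

theorem quad_encodeIdeal {n : ℕ} (hn : 2 ≤ n) (gens : List (NegacyclicRing n)) {j k : ℕ}
    (hj : j < gens.length) (hk : k < 2 ^ n / 4) :
    quad (initMem (encodeIdeal n gens)) (2 ^ n) (j * (2 ^ n / 4) + k : ℕ) =
      component n k gens[j] := by
  have h4 := two_pow_eq hn
  have hw : (2 : ℤ) ^ n / 4 + 2 / 2 ^ n = (2 ^ n / 4 : ℕ) := by
    rcases quarter_eq (n := n) (by omega) with ⟨h, -⟩ | ⟨-, h⟩
    · omega
    · rw [h]; simp
  have h2 : (2 : ℤ) / 2 ^ n = 0 := by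
    rcases quarter_eq (n := n) (by omega) with ⟨h, -⟩ | ⟨-, h⟩
    · omega
    · exact h
  have hdiv : (j * (2 ^ n / 4) + k) / (2 ^ n / 4) = j := by
    rw [add_comm, Nat.add_mul_div_right _ _ (by omega), Nat.div_eq_of_lt hk, zero_add]
  have hdiv' : ((j * (2 ^ n / 4) + k : ℕ) : ℤ) / (2 ^ n / 4 : ℕ) = (j : ℕ) := by
    rw [← Int.natCast_div, hdiv]
  have hb : (2 : ℤ) + j * 2 ^ n + (((j * (2 ^ n / 4) + k : ℕ) : ℤ) - j * (2 ^ n / 4 : ℕ)) =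
      (2 + j * 2 ^ n + k : ℕ) := by push_cast; ring
  have hq : (2 : ℤ) ^ n / 4 = (2 ^ n / 4 : ℕ) := by simp
  have hh : (2 : ℤ) ^ n / 2 = (2 * (2 ^ n / 4) : ℕ) := by
    rw [show 2 * (2 ^ n / 4) = 2 ^ n / 2 by omega]; simp
  simp only [quad]
  rw [hw, hdiv', hb, h2, hq, hh, ← Nat.cast_add, ← Nat.cast_add, ← Nat.cast_add, sub_zero, one_mul,
    one_mul, add_assoc _ k, add_assoc _ k, add_assoc _ (k + _), add_assoc k,
    show 2 * (2 ^ n / 4) + 2 ^ n / 4 = 3 * (2 ^ n / 4) by ring,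
    initMem_encodeIdeal gens hj (by omega), initMem_encodeIdeal gens hj (by omega),
    initMem_encodeIdeal gens hj (by omega), initMem_encodeIdeal gens hj (by omega), component]

theorem image_quad_encodeIdeal {n : ℕ} (hn : 2 ≤ n) (gens : List (NegacyclicRing n)) :
    (fun j : ℕ => quad (initMem (encodeIdeal n gens)) (2 ^ n) j) ''
        Set.Iio (gens.length * (2 ^ n / 4)) =
      {z | ∃ g ∈ {g | g ∈ gens}, ∃ k < 2 ^ n / 4, z = component n k g} := by
  have hq : 0 < 2 ^ n / 4 := by have := two_pow_eq hn; have := Nat.two_pow_pos n; omega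
  ext z
  constructor
  · rintro ⟨i, hi, rfl⟩
    have hj : i / (2 ^ n / 4) < gens.length := Nat.div_lt_of_lt_mul (by rwa [mul_comm])
    have hk := Nat.mod_lt i hq
    refine ⟨gens[i / (2 ^ n / 4)], List.getElem_mem hj, _, hk, ?_⟩
    rw [← quad_encodeIdeal hn gens hj hk, Nat.div_add_mod']
  · rintro ⟨g, hg, k, hk, rfl⟩
    obtain ⟨j, hj, rfl⟩ := List.getElem_of_mem hg
    refine ⟨j * (2 ^ n / 4) + k, ?_, quad_encodeIdeal hn gens hj hk⟩
    calc j * (2 ^ n / 4) + k < (j + 1) * (2 ^ n / 4) := by rw [add_mul]; omega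
      _ ≤ _ := Nat.mul_le_mul_right _ hj

theorem image_quad_encodeIdeal_one (gens : List (NegacyclicRing 1)) :
    (fun j : ℕ => quad (initMem (encodeIdeal 1 gens)) (2 ^ 1) j) '' Set.Iio gens.length =
      gaussToZ8 '' {g | g ∈ gens} := by
  have key : ∀ j (hj : j < gens.length),
      quad (initMem (encodeIdeal 1 gens)) (2 ^ 1) j = gaussToZ8 gens[j] := by
    intro j hj
    have h0 := initMem_encodeIdeal gens hj (i := 0) (by norm_num)
    have h1 := initMem_encodeIdeal gens hj (i := 1) (by norm_num)
    push_cast at h0 h1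
    norm_num [quad, gaussToZ8] at h0 h1 ⊢
    exact ⟨h0, h1⟩
  ext z
  constructor
  · rintro ⟨j, hj, rfl⟩
    exact ⟨gens[j], List.getElem_mem hj, (key j hj).symm⟩
  · rintro ⟨g, hg, rfl⟩
    obtain ⟨j, hj, rfl⟩ := List.getElem_of_mem hg
    exact ⟨j, hj, key j hj⟩

/-- The product of the primes `p i` is a nonzero integer in the ideal, and nonzero integers stay
nonzero in the ring. -/
theorem prod_ne_bot {n s : ℕ} {𝔭 : Fin s → Ideal (NegacyclicRing n)}
    (h : ∀ i, ∃ p : ℕ, p.Prime ∧ (p : NegacyclicRing n) ∈ 𝔭 i) : ∏ i, 𝔭 i ≠ ⊥ := by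
  choose p hp hmem using h
  intro hbot
  have h1 : ∏ i, (p i : NegacyclicRing n) ∈ ∏ i, 𝔭 i := Ideal.prod_mem_prod fun i _ => hmem i
  rw [hbot, Ideal.mem_bot] at h1
  have h2 := ringCoeff_intCast_zero n (∏ i, (p i : ℤ))
  push_cast at h2
  rw [h1, ← ringCoeffHom_apply, map_zero] at h2
  exact Finset.prod_ne_zero_iff.2 (fun i _ => by exact_mod_cast (hp i).ne_zero) h2.symm

theorem mainTheorem5 :
    ∃ P : Prog, ∀ d : ℕ, ∃ C k : ℕ,
      ∀ (n : ℕ), 0 < n →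
      ∀ (I : Ideal (NegacyclicRing n)) (s : ℕ) (𝔭 : Fin s → Ideal (NegacyclicRing n)),
        I = ∏ i, 𝔭 i →
        (∀ i, (𝔭 i).IsPrime ∧
          ∃ p : ℕ, p.Prime ∧ ((p : ℤ) ≡ 3 [ZMOD 8] ∨ (p : ℤ) ≡ -3 [ZMOD 8]) ∧
            (p : NegacyclicRing n) ∈ 𝔭 i) →
      ∀ gens : List (NegacyclicRing n),
        Ideal.span {g | g ∈ gens} = I →
        inputSize (encodeIdeal n gens) ≤ (2 ^ n + Nat.log 2 (idealNorm n I)) ^ d →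
        ∃ (ν : Mem) (t : ℕ) (v : NegacyclicRing n),
          Exec P (initMem (encodeIdeal n gens)) ν t ∧
          t ≤ C * (2 ^ n + Nat.log 2 (idealNorm n I)) ^ k ∧
          IsShortestVector n I v ∧
          ∀ i : Fin (2 ^ n), ν ((i : ℕ) : ℤ) = ringCoeff n v i := by
  obtain ⟨K, hK⟩ := exec_svpProg
  -- The cost is at most `K * L ^ 6` in the input size `L`; the ideal norm enters only through the
  -- assumed bound on `L`.
  refine ⟨svpProg, fun d => ⟨K, d * 6, fun n hn I s 𝔭 hI h𝔭 gens hgens hsize => ?_⟩⟩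
  have hne : I ≠ ⊥ := hI ▸ prod_ne_bot fun i => by
    obtain ⟨-, p, hp, -, hmem⟩ := h𝔭 i
    exact ⟨p, hp, hmem⟩
  have hm : 0 < gens.length := by
    rw [List.length_pos_iff]
    rintro rfl
    apply hne
    rw [← hgens]
    simp
  set f := initMem (encodeIdeal n gens) with hf
  have hlen : gens.length * 2 ^ n ≤ inputSize (encodeIdeal n gens) := by
    have := length_le_inputSize (encodeIdeal n gens)
    rw [length_encodeIdeal] at this
    omega
  have hcost : ∀ t, t ≤ K * inputSize (encodeIdeal n gens) ^ 6 →
      t ≤ K * (2 ^ n + Nat.log 2 (idealNorm n I)) ^ (d * 6) := fun t ht =>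
    ht.trans (Nat.mul_le_mul_left _ (by rw [pow_mul]; exact Nat.pow_le_pow_left hsize 6))
  have hrun := hK f n gens.length (inputSize (encodeIdeal n gens)) hn (abs_initMem_le _)
    (by simp [hf, initMem, encodeIdeal]) (by simp [hf, initMem, encodeIdeal])
    (fun c hc => by rw [hf, initMem, if_neg (by omega)]) hlen hm
  rcases quarter_eq hn with ⟨rfl, hw⟩ | ⟨hn2, hw⟩
  · obtain ⟨ν, t, z, hr, ht, hspan, -, heven, hout⟩ := hrun gens.length (by norm_num)
    obtain ⟨h1, h3⟩ := heven rfl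
    rw [hf, image_quad_encodeIdeal_one] at hspan
    have hz0 : z ≠ 0 := by
      rintro rfl
      apply hne
      rw [← hgens, Ideal.span_eq_bot]
      intro g hg
      have : gaussToZ8 g ∈ Ideal.span {(0 : Z8)} := hspan ▸ Ideal.subset_span ⟨g, hg, rfl⟩
      rw [Ideal.mem_span_singleton, zero_dvd_iff] at this
      rw [← gaussOfZ8_toZ8 g, this, gaussOfZ8_zero]
    refine ⟨ν, t, gaussOfZ8 z, hr, hcost t ht,
      hgens ▸ isShortestVector_gaussOfZ8 hz0 hspan h1 h3, fun i => ?_⟩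
    obtain ⟨e0, e2⟩ := ringCoeff_gaussOfZ8 z
    rw [hout i i.2]
    fin_cases i
    · exact e0.symm
    · exact e2.symm
  · obtain ⟨ν, t, z, hr, ht, hspan, hred, -, hout⟩ := hrun (gens.length * (2 ^ n / 4))
      (by rw [hw]; simp)
    -- The factorization serves only to show that `J` exists; the program works from the components
    -- of the generators.
    obtain ⟨J, hJ⟩ := exists_eq_map_fromZ8_of_prod hn2 (𝔭 := 𝔭) fun i => by
      obtain ⟨hprime, p, hp, h8, hmem⟩ := h𝔭 i
      refine exists_eq_map_fromZ8_of_isPrime hn2 hprime hp ?_ hmem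
      simp only [Int.ModEq] at h8
      omega
    rw [hf, image_quad_encodeIdeal hn2, span_component hn2 (hgens.trans (hI.trans hJ))] at hspan
    rw [← hI, ← hspan] at hJ
    have hz0 : z ≠ 0 := by
      rintro rfl
      apply hne
      rw [hJ, Ideal.span_singleton_eq_bot.2 rfl, Ideal.map_bot]
    refine ⟨ν, t, fromZ8 hn2 z, hr, hcost t ht, ?_, fun i => ?_⟩
    · rw [hJ]
      exact isShortestVector_fromZ8 hn2 hz0 hred
    · rw [hout i i.2, ringCoeff_fromZ8 hn2 z i.2]
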